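/- Let $0<y<\tfrac12$, $\alpha_c=\frac{1-\sqrt{1-4y^2}}{2y}$ and $0\le\alpha<\alpha_c$. On the Fock space $\mathbb F_{ab}=\ell^2(\mathbb N\times\mathbb N)$ with orthonormal basis $|m,n\rangle$ and the annihilation and creation operators $a,b,a^*,b^*$ of two boson species, let $$H_{ab}=\tfrac12(a^*a+b^*b)+y(a^*b^*+ab),\qquad H_{ab}^{(\alpha)}=\frac{1}{1-2\alpha y}\Big(e^{\alpha a^*b^*}H_{ab}\,e^{-\alpha a^*b^*}+\alpha y\Big),$$ where the operators act on formal series $\sum c_{m,n}|m,n\rangle$ (each coefficient of the image is a finite sum) and each of the two Hamiltonians is taken with its maximal domain $\{\Psi\in\mathbb F_{ab}: H\Psi\in\mathbb F_{ab}\}$. Let $\sigma_p$ denote the point spectrum (the set of eigenvalues). Put $y_1=\frac{y}{1-2\alpha y}$, $y_2=\frac{y-\alpha+\alpha^2y}{1-2\alpha y}$ and $z_\pm=\frac{-1\pm\sqrt{1-4y_1y_2}}{2y_2}$ (so that $z_-<z_+<0$ and $z_-<-1$), and assume $|z_+|<1$. For an integer $p>0$, a constant $C_0\in\mathbb C\setminus\{0\}$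 and $B\in\mathbb C$, put $C=p-1-B$ and $$I(z)=\frac{C_0y_1p}{y_2}(z-z_+)^B(z-z_-)^C\int_0^z u^{p-1}(u-z_+)^{-(1+B)}(u-z_-)^{-(1+C)}\,du,\qquad G(z)=z^{-p}I(z),$$ with principal branches and integration along a segment, for $z\ne0$ in the unit disk slit along $(-1,z_+]$. Such a function is called analytic in the unit disk if it extends from this set to an analytic function on $\{|z|<1\}$. Then: 1. $G$ is analytic in the unit disk if and only if $B\in\mathbb N$ and $B\ge p$; the same equivalence holds for $I$. 2. Let $p>0$, and let $\Psi=\sum_{s\ge0}c_s|p+s,s\rangle\in\mathbb F_{ab}$ (or $\Psi=\sum_{s\ge0}c_s|s,p+s\rangle$) be an eigenvector of $H^{(\alpha)}_{ab}$ with eigenvalue $E$, and let $C_s=\sqrt{s!/(p+s)!}\,c_s$. Then $C_0\neq0$, and the generating function $\sum_{s\ge0}C_sz^s$ of $\Psi$ equals $G(z)$ for all $z\ne 0$ in the slit disk, for this $C_0$ and the exponent $$B=\frac{(p/2-E-1)z_++y_1(p-1)}{z_++2y_1}.$$ 3. $\sigma_p(H^{(\alpha)}_{ab})$ is a closed discrete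 subset of $\mathbb C$. 4. $(1-2\alpha y)\,\sigma_p(H^{(\alpha)}_{ab})-\alpha y=\sigma_p(H_{ab})$, and this set is the Bogoliubov spectrum $$\Big\{\tfrac12(n_a+n_b)\sqrt{1-4y^2}+\tfrac12\big(\sqrt{1-4y^2}-1\big):\ n_a,n_b\in\mathbb N\Big\}.$$ -/

import Mathlib

open scoped ENNReal

noncomputable section

namespace TwoSpecies

/-! ### The two-species Fock space and its operators -/

/-- Formal vectors `∑ Φ (m, n) |m, n⟩`, with no summability condition. -/
abbrev Formal : Type := ℕ × ℕ → ℂ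

/-- The Fock space of two particle species: the square summable formal vectors. The orthonormal
basis vector `|m, n⟩` is the indicator of `(m, n)`. -/
abbrev Fock : Type := lp (fun _ : ℕ × ℕ => ℂ) 2

/-- The annihilation operator `a`, with `a |m, n⟩ = √m |m - 1, n⟩`. -/
def annA : Module.End ℂ Formal where
  toFun Φ x := (√((x.1 : ℝ) + 1) : ℂ) * Φ (x.1 + 1, x.2)
  map_add' Φ Ψ := by ext x; simp [mul_add]
  map_smul' c Φ := by ext x; simp [mul_left_comm]

/-- The annihilation operator `b`, with `b |m, n⟩ = √n |m, n - 1⟩`. -/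
def annB : Module.End ℂ Formal where
  toFun Φ x := (√((x.2 : ℝ) + 1) : ℂ) * Φ (x.1, x.2 + 1)
  map_add' Φ Ψ := by ext x; simp [mul_add]
  map_smul' c Φ := by ext x; simp [mul_left_comm]

/-- The creation operator `a*`, with `a* |m, n⟩ = √(m + 1) |m + 1, n⟩`. The truncated subtraction
at `x.1 = 0` is harmless because its coefficient `√0` vanishes. -/
def creA : Module.End ℂ Formal where
  toFun Φ x := (√(x.1 : ℝ) : ℂ) * Φ (x.1 - 1, x.2)
  map_add' Φ Ψ := by ext x; simp [mul_add]
  map_smul' c Φ := by ext x; simp [mul_left_comm]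

/-- The creation operator `b*`, with `b* |m, n⟩ = √(n + 1) |m, n + 1⟩`. -/
def creB : Module.End ℂ Formal where
  toFun Φ x := (√(x.2 : ℝ) : ℂ) * Φ (x.1, x.2 - 1)
  map_add' Φ Ψ := by ext x; simp [mul_add]
  map_smul' c Φ := by ext x; simp [mul_left_comm]

/-- The exponential `exp (t a* b*)` on formal vectors. The coefficient of `(a* b*) ^ j Φ` at
`(m, n)` vanishes as soon as `j > min m n`, so the exponential series is a finite sum in each
coefficient. -/
def expPair (t : ℂ) : Module.End ℂ Formal where
  toFun Φ x := ∑ j ∈ Finset.range (min x.1 x.2 + 1),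
    t ^ j / (j.factorial : ℂ) * ((creA * creB) ^ j) Φ x
  map_add' Φ Ψ := by ext x; simp [mul_add, Finset.sum_add_distrib]
  map_smul' c Φ := by
    ext x
    simp only [map_smul, Pi.smul_apply, smul_eq_mul, RingHom.id_apply, Finset.mul_sum]
    exact Finset.sum_congr rfl fun j _ => by ring

/-- The Hamiltonian `H_ab(y) = (a* a + b* b) / 2 + y (a* b* + a b)`. -/
def hamiltonian (y : ℝ) : Module.End ℂ Formal :=
  (1 / 2 : ℂ) • (creA * annA + creB * annB) + (y : ℂ) • (creA * creB + annA * annB)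

/-- The rescaled transformed Hamiltonian
`(1 - 2 α y)⁻¹ (exp (α a* b*) H_ab exp (-α a* b*) + α y)`. -/
def transformedHamiltonian (y α : ℝ) : Module.End ℂ Formal :=
  (1 / (1 - 2 * α * y) : ℂ) •
    (expPair α * hamiltonian y * expPair (-α) + (α * y : ℂ) • (1 : Module.End ℂ Formal))

/-- The unbounded operator on Fock space given by a formal operator `T` on its maximal domain
`{Ψ ∈ Fock | T Ψ ∈ Fock}`. -/
def realize (T : Module.End ℂ Formal) : Fock →ₗ.[ℂ] Fock where
  domain :=
    { carrier := {Ψ | Memℓp (T (Ψ : Formal)) 2}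
      add_mem' := by
        intro Φ Ψ hΦ hΨ
        have h : T ((Φ + Ψ : Fock) : Formal) = T (Φ : Formal) + T (Ψ : Formal) := by
          rw [← map_add]; rfl
        simpa only [Set.mem_ofPred_eq, h] using Memℓp.add hΦ hΨ
      zero_mem' := by
        have h : T ((0 : Fock) : Formal) = 0 := map_zero T
        simpa only [Set.mem_ofPred_eq, h] using
          (zero_memℓp : Memℓp (0 : ∀ _ : ℕ × ℕ, ℂ) 2)
      smul_mem' := by
        intro c Ψ hΨ
        have h : T ((c • Ψ : Fock) : Formal) = c • T (Ψ : Formal) := by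
          rw [← map_smul]; rfl
        simpa only [Set.mem_ofPred_eq, h] using Memℓp.const_smul hΨ c }
  toFun :=
    { toFun := fun Ψ => ⟨T ((Ψ : Fock) : Formal), Ψ.2⟩
      map_add' := fun Φ Ψ => Subtype.ext (map_add T ((Φ : Fock) : Formal) ((Ψ : Fock) : Formal))
      map_smul' := fun c Ψ => Subtype.ext (map_smul T c ((Ψ : Fock) : Formal)) }

/-- `Ψ` is an eigenvector of the unbounded operator `T`, with eigenvalue `E`. -/
def IsEigenstate (T : Fock →ₗ.[ℂ] Fock) (E : ℂ) (Ψ : Fock) : Prop :=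
  Ψ ≠ 0 ∧ ∃ h : Ψ ∈ T.domain, T ⟨Ψ, h⟩ = E • Ψ

/-- The point spectrum `σ_p(T)`: the set of eigenvalues. -/
def pointSpectrum (T : Fock →ₗ.[ℂ] Fock) : Set ℂ :=
  {E | ∃ Ψ : Fock, IsEigenstate T E Ψ}

/-! ### Parameters -/

/-- The critical parameter `α_c`. -/
def alphaC (y : ℝ) : ℝ := (1 - √(1 - 4 * y ^ 2)) / (2 * y)

/-- The coefficient `y₁(α)` of `a b`. -/
def y₁ (y α : ℝ) : ℝ := y / (1 - 2 * α * y)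

/-- The coefficient `y₂(α)` of `a* b*`. -/
def y₂ (y α : ℝ) : ℝ := (y - α + α ^ 2 * y) / (1 - 2 * α * y)

/-- The root `z₊(α)` of `y₂ z ^ 2 + z + y₁`. -/
def zPlus (y α : ℝ) : ℝ := (-1 + √(1 - 4 * y₁ y α * y₂ y α)) / (2 * y₂ y α)

/-- The root `z₋(α)` of `y₂ z ^ 2 + z + y₁`. -/
def zMinus (y α : ℝ) : ℝ := (-1 - √(1 - 4 * y₁ y α * y₂ y α)) / (2 * y₂ y α)

/-- The exponent `B` that belongs to the energy `E`. -/
def exponentB (y α : ℝ) (p : ℕ) (E : ℂ) : ℂ :=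
  (((p : ℂ) / 2 - E - 1) * zPlus y α + y₁ y α * ((p : ℂ) - 1)) / (zPlus y α + 2 * y₁ y α)

/-! ### Generating functions -/

/-- The basis labels `s ↦ (p + s, s)`, spanning the fibre where `a* a - b* b = p`. -/
def fibrePos (p : ℕ) (s : ℕ) : ℕ × ℕ := (p + s, s)

/-- The basis labels `s ↦ (s, p + s)`, spanning the fibre where `b* b - a* a = p`. -/
def fibreNeg (p : ℕ) (s : ℕ) : ℕ × ℕ := (s, p + s)

/-- The rescaled coefficients `C_s = √(s! / (p + s)!) c_s` of a vector `∑ c_s |ι s⟩`, where `ι` is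
one of the two fibres. -/
def rescaledCoeff (p : ℕ) (ι : ℕ → ℕ × ℕ) (Ψ : Fock) (s : ℕ) : ℂ :=
  (√((s.factorial : ℝ) / ((p + s).factorial : ℝ)) : ℂ) * (Ψ : Formal) (ι s)

/-- The function
`(C₀ y₁ p / y₂) (z - z₊)^B (z - z₋)^C ∫₀ᶻ u^(p-1) (u - z₊)^(-(1+B)) (u - z₋)^(-(1+C)) du`,
`C = p - 1 - B`, with principal branches, the contour being the segment `u = t z`, `0 ≤ t ≤ 1`. -/
def integralFormula (y α : ℝ) (p : ℕ) (C₀ B z : ℂ) : ℂ :=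
  C₀ * y₁ y α * p / y₂ y α * (z - zPlus y α) ^ B * (z - zMinus y α) ^ ((p : ℂ) - 1 - B) *
    ∫ t in (0 : ℝ)..1,
      ((t * z) ^ (p - 1) * (t * z - zPlus y α) ^ (-(1 + B)) *
        (t * z - zMinus y α) ^ (-(1 + ((p : ℂ) - 1 - B)))) * z

/-- The generating function `z^(-p) * integralFormula`. -/
def genFun (y α : ℝ) (p : ℕ) (C₀ B z : ℂ) : ℂ :=
  integralFormula y α p C₀ B z / z ^ p

/-- The unit disk without `0` and without the ray `(-∞, z₊]`. With `z₋ < z₊ < 0`, the slit disk is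
star-shaped about `0` and carries holomorphic principal branches of the powers of `z - z₊` and
`z - z₋`. -/
def slitDisk (y α : ℝ) : Set ℂ :=
  {z | ‖z‖ < 1 ∧ z ≠ 0 ∧ z - zPlus y α ∈ Complex.slitPlane}

/-- `G`, given on the slit disk, is analytic in the unit disk: it has no singularity there other
than removable ones. -/
def AnalyticInDisk (y α : ℝ) (G : ℂ → ℂ) : Prop :=
  ∃ F : ℂ → ℂ, AnalyticOnNhd ℂ F (Metric.ball 0 1) ∧ Set.EqOn F G (slitDisk y α)

/-- The Bogoliubov spectrum of `H_ab(y)`: quanta of energy `√(1 - 4 y ^ 2) / 2` of two species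
above the ground state energy `(√(1 - 4 y ^ 2) - 1) / 2`. -/
def bogoliubovSpectrum (y : ℝ) : Set ℂ :=
  {E | ∃ na nb : ℕ, E = (((na + nb : ℝ) / 2 * √(1 - 4 * y ^ 2) +
    (√(1 - 4 * y ^ 2) - 1) / 2 : ℝ) : ℂ)}

end TwoSpecies

end

open TwoSpecies

namespace TwoSpecies

open Filter Topology

/-! ### Formal operators -/

/-! Conjugation by `exp (α a* b*)` sends `a` to `a - α b*` and `b` to `b - α a*`. After the shift
and rescaling, the Hamiltonian is the pair operator with coefficient `β = y₁` of `a b` and `γ = y₂`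
of `a* b*` (`transformedHamiltonian_eq_pairOperator`). This operator preserves `a* a - b* b`, so an
eigenvector restricts to a solution of a three-term recurrence on each fibre. The rescaled
coefficients are bounded, so their generating function `g` is analytic in the unit disk and
satisfies a first-order differential equation.

Write `γ z ^ 2 + z + β = γ (z - a) (z - b)` with `b < -1 < a < 0`; only `a` lies in the disk. For `p
> 0` the function `F = z ^ p g` satisfies `F 0 = 0` and `(z - a) (z - b) F' - (B (z - b) + (p - 1 -
B) (z - a)) F = K z ^ (p - 1)`. Variation of constants gives the integral formula
(`eq_rootIntegral`); conversely, an analytic continuation of that formula solves the equation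
(`fuchsOp_of_eq_rootIntegral`).

Analyticity at `a` quantises `B` (`exponent_of_inhomogeneous`). The products `(z - a) ^ k (z - b) ^
(p - 1 - k)` are eigenfunctions of the left side with eigenvalues `(k - B) (a - b)`. Expanding `z ^
(p - 1)` in them gives a polynomial solution `S` when no eigenvalue vanishes. If `B` is not a
natural number, a homogeneous analytic solution must vanish, so `F = S`; but `S 0 ≠ 0` by a partial
fraction identity. If `B` is a natural number below `p`, the source has a resonant term that no
analytic function can produce. For `p = 0` the equation is homogeneous and the order of vanishing at
`a` is the exponent.

Conversely, for `B = p + k` the recurrence has the solution `b ^ (-s)` times a polynomial of degree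
`k` in `s`, whose generating function supplies the continuation. The case `k = 0` on the fibre `p =
N` already realises every energy level. The original Hamiltonian is the case `α = 0`. -/

theorem annA_apply (Φ : Formal) (m n : ℕ) :
    annA Φ (m, n) = (√((m : ℝ) + 1) : ℂ) * Φ (m + 1, n) := rfl

theorem annB_apply (Φ : Formal) (m n : ℕ) :
    annB Φ (m, n) = (√((n : ℝ) + 1) : ℂ) * Φ (m, n + 1) := rfl

theorem creA_apply (Φ : Formal) (m n : ℕ) :
    creA Φ (m, n) = (√(m : ℝ) : ℂ) * Φ (m - 1, n) := rfl

theorem creB_apply (Φ : Formal) (m n : ℕ) :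
    creB Φ (m, n) = (√(n : ℝ) : ℂ) * Φ (m, n - 1) := rfl

theorem ofReal_sqrt_mul_self {x : ℝ} (hx : 0 ≤ x) : (√x : ℂ) * (√x : ℂ) = (x : ℂ) := by
  rw [← Complex.ofReal_mul, Real.mul_self_sqrt hx]

theorem creA_annA_apply (Φ : Formal) (m n : ℕ) : (creA * annA) Φ (m, n) = m * Φ (m, n) := by
  rcases m with _ | m
  · simp [Module.End.mul_apply, creA_apply]
  · have h := ofReal_sqrt_mul_self (x := (m : ℝ) + 1) (by positivity)
    simp only [Module.End.mul_apply, creA_apply, annA_apply, Nat.add_sub_cancel]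
    push_cast at h ⊢
    linear_combination Φ (m + 1, n) * h

theorem creB_annB_apply (Φ : Formal) (m n : ℕ) : (creB * annB) Φ (m, n) = n * Φ (m, n) := by
  rcases n with _ | n
  · simp [Module.End.mul_apply, creB_apply]
  · have h := ofReal_sqrt_mul_self (x := (n : ℝ) + 1) (by positivity)
    simp only [Module.End.mul_apply, creB_apply, annB_apply, Nat.add_sub_cancel]
    push_cast at h ⊢
    linear_combination Φ (m, n + 1) * h

theorem annA_mul_creA : annA * creA = creA * annA + 1 := by
  ext Φ ⟨m, n⟩
  have h := ofReal_sqrt_mul_self (x := (m : ℝ) + 1) (by positivity)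
  rw [LinearMap.add_apply, Pi.add_apply, creA_annA_apply]
  simp only [Module.End.mul_apply, Module.End.one_apply, creA_apply, annA_apply,
    Nat.add_sub_cancel]
  push_cast at h ⊢
  linear_combination Φ (m, n) * h

theorem annB_mul_creB : annB * creB = creB * annB + 1 := by
  ext Φ ⟨m, n⟩
  have h := ofReal_sqrt_mul_self (x := (n : ℝ) + 1) (by positivity)
  rw [LinearMap.add_apply, Pi.add_apply, creB_annB_apply]
  simp only [Module.End.mul_apply, Module.End.one_apply, creB_apply, annB_apply,
    Nat.add_sub_cancel]
  push_cast at h ⊢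
  linear_combination Φ (m, n) * h

theorem commute_annA_creB : Commute annA creB := by
  ext Φ ⟨m, n⟩
  simp only [Module.End.mul_apply, creB_apply, annA_apply]
  ring

theorem commute_annB_creA : Commute annB creA := by
  ext Φ ⟨m, n⟩
  simp only [Module.End.mul_apply, creA_apply, annB_apply]
  ring

theorem commute_creA_creB : Commute creA creB := by
  ext Φ ⟨m, n⟩
  simp only [Module.End.mul_apply, creA_apply, creB_apply]
  ring

/-! ### Conjugation by the exponential of the pair creation operator -/

theorem pair_pow_apply_eq_zero (Φ : Formal) (j : ℕ) :
    ∀ x : ℕ × ℕ, min x.1 x.2 < j → ((creA * creB) ^ j) Φ x = 0 := by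
  induction j with
  | zero => intro x hx; omega
  | succ j ih =>
    rintro ⟨m, n⟩ hx
    rw [pow_succ', Module.End.mul_apply, Module.End.mul_apply, creA_apply, creB_apply]
    rcases m with _ | m
    · simp
    rcases n with _ | n
    · simp
    rw [ih]
    · simp
    · simp only at hx ⊢; omega

/-- Terms past the cut-off vanish, so exponentials evaluated at different sites can be summed over a
common range. -/
theorem expPair_apply_of_lt (t : ℂ) (Φ : Formal) (x : ℕ × ℕ) (N : ℕ) (hN : min x.1 x.2 < N) :
    expPair t Φ x = ∑ j ∈ Finset.range N,
      t ^ j / (j.factorial : ℂ) * ((creA * creB) ^ j) Φ x := by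
  refine Finset.sum_subset (Finset.range_mono hN) fun j _ hj => ?_
  rw [pair_pow_apply_eq_zero Φ j x, mul_zero]
  simp only [Finset.mem_range] at hj
  omega

/-- A commutation rule with `a* b*` in which the commutator `c` commutes with `a* b*` passes to
the powers of `a* b*`. -/
theorem mul_pow_of_commutator {R : Type*} [Ring R] {x a c : R} (h : x * a = a * x + c)
    (hc : Commute c a) (j : ℕ) : x * a ^ (j + 1) = a ^ (j + 1) * x + (j + 1) * (c * a ^ j) := by
  induction j with
  | zero => simp [h]
  | succ j ih =>
    have e : c * a ^ j * a = c * a ^ (j + 1) := by rw [mul_assoc, ← pow_succ]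
    have e2 : a ^ (j + 1) * c = c * a ^ (j + 1) := ((hc.pow_right (j + 1)).eq).symm
    calc x * a ^ (j + 1 + 1) = x * a ^ (j + 1) * a := by rw [pow_succ a (j + 1), mul_assoc]
      _ = a ^ (j + 1) * (x * a) + (j + 1) * (c * a ^ j * a) := by
          rw [ih, add_mul, mul_assoc, mul_assoc]
      _ = a ^ (j + 1 + 1) * x + ((j + 1 : ℕ) + 1) * (c * a ^ (j + 1)) := by
          rw [h, e, mul_add, e2, ← mul_assoc, ← pow_succ]
          push_cast
          noncomm_ring

/-- `exp (t a* b*)` conjugates `T` to `T - t c` when `c = [T, a* b*]` commutes with `a* b*`. The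
hypotheses `hT` and `hcl` say that `T` and `c` act locally in each coefficient. -/
theorem expPair_mul_of_commutator (t : ℂ) {T c : Module.End ℂ Formal}
    (h : T * (creA * creB) = creA * creB * T + c) (hc : Commute c (creA * creB))
    (hT : ∀ x, ∃ (y : ℕ × ℕ) (k : ℂ), ∀ Φ, T Φ x = k * Φ y)
    (hcl : ∀ x, ∃ (y : ℕ × ℕ) (k : ℂ), ∀ Φ, c Φ x = k * Φ y) :
    expPair t * T = (T - t • c) * expPair t := by
  ext Φ x
  obtain ⟨u, k, hu⟩ := hT x
  obtain ⟨v, l, hv⟩ := hcl x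
  -- `N` exceeds the cut-offs at `x` and at the sites `u`, `v` read by `T` and `c`. The sum for `c`
  -- below stops one term earlier, to match the shift from `j + 1` to `j`.
  set N := x.1 + x.2 + u.1 + u.2 + v.1 + v.2 + 1 with hN
  have e1 : ∀ j : ℕ, ((creA * creB) ^ (j + 1)) (T Φ) x =
      T (((creA * creB) ^ (j + 1)) Φ) x - (j + 1) * c (((creA * creB) ^ j) Φ) x := by
    intro j
    have := congrArg (fun S : Module.End ℂ Formal => S Φ x) (mul_pow_of_commutator h hc j)
    have cast_apply : ((j + 1 : Module.End ℂ Formal) * (c * (creA * creB) ^ j)) Φ x =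
        ((j : ℂ) + 1) * c (((creA * creB) ^ j) Φ) x := by
      have : (j + 1 : Module.End ℂ Formal) = ((j : ℂ) + 1) • 1 := by
        rw [add_smul, one_smul, Nat.cast_smul_eq_nsmul, nsmul_one]
      rw [this, smul_mul_assoc, one_mul]
      rfl
    simp only [LinearMap.add_apply, Pi.add_apply, cast_apply] at this
    simp only [Module.End.mul_apply] at this ⊢
    rw [this]; ring
  have lhs : (expPair t * T) Φ x = ∑ j ∈ Finset.range (N + 1),
      t ^ j / (j.factorial : ℂ) * ((creA * creB) ^ j) (T Φ) x :=
    expPair_apply_of_lt t (T Φ) x (N + 1) (by omega)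
  have rhs1 : T (expPair t Φ) x = ∑ j ∈ Finset.range (N + 1),
      t ^ j / (j.factorial : ℂ) * T (((creA * creB) ^ j) Φ) x := by
    rw [hu, expPair_apply_of_lt t Φ u (N + 1) (by omega), Finset.mul_sum]
    refine Finset.sum_congr rfl fun j _ => ?_
    rw [hu]; ring
  have rhs2 : c (expPair t Φ) x = ∑ j ∈ Finset.range N,
      t ^ j / (j.factorial : ℂ) * c (((creA * creB) ^ j) Φ) x := by
    rw [hv, expPair_apply_of_lt t Φ v N (by omega), Finset.mul_sum]
    refine Finset.sum_congr rfl fun j _ => ?_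
    rw [hv]; ring
  have rhs : ((T - t • c) * expPair t) Φ x = T (expPair t Φ) x - t * c (expPair t Φ) x := rfl
  rw [lhs, rhs, rhs1, rhs2, Finset.sum_range_succ', Finset.sum_range_succ' _ N, Finset.mul_sum]
  simp only [e1, pow_zero, Module.End.one_apply, mul_sub, Finset.sum_sub_distrib]
  have : ∀ j : ℕ, t ^ (j + 1) / ((j + 1).factorial : ℂ) *
      (((j : ℂ) + 1) * c (((creA * creB) ^ j) Φ) x) =
      t * (t ^ j / (j.factorial : ℂ) * c (((creA * creB) ^ j) Φ) x) := by
    intro j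
    have h1 : (j.factorial : ℂ) ≠ 0 := by exact_mod_cast j.factorial_ne_zero
    have h2 : (j : ℂ) + 1 ≠ 0 := by exact_mod_cast j.succ_ne_zero
    rw [Nat.factorial_succ]
    push_cast
    field_simp
    ring
  simp only [this]
  ring

theorem expPair_mul_annA (t : ℂ) : expPair t * annA = (annA - t • creB) * expPair t := by
  refine expPair_mul_of_commutator t ?_ ?_ ?_ ?_
  · rw [← mul_assoc, annA_mul_creA, add_mul, one_mul, mul_assoc, commute_annA_creB.eq, mul_assoc]
  · exact (commute_creA_creB.symm).mul_right (Commute.refl _)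
  · rintro ⟨m, n⟩; exact ⟨_, _, fun Φ => annA_apply Φ m n⟩
  · rintro ⟨m, n⟩; exact ⟨_, _, fun Φ => creB_apply Φ m n⟩

theorem expPair_mul_annB (t : ℂ) : expPair t * annB = (annB - t • creA) * expPair t := by
  refine expPair_mul_of_commutator t ?_ ?_ ?_ ?_
  · rw [← mul_assoc, commute_annB_creA.eq, mul_assoc, annB_mul_creB, mul_add, mul_one, mul_assoc]
  · exact (Commute.refl _).mul_right commute_creA_creB
  · rintro ⟨m, n⟩; exact ⟨_, _, fun Φ => annB_apply Φ m n⟩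
  · rintro ⟨m, n⟩; exact ⟨_, _, fun Φ => creA_apply Φ m n⟩

theorem expPair_mul_creA (t : ℂ) : expPair t * creA = creA * expPair t := by
  have := expPair_mul_of_commutator t (T := creA) (c := 0) ?_ ?_ ?_ ?_
  · simpa using this
  · rw [add_zero]
    exact ((Commute.refl _).mul_right commute_creA_creB).eq
  · exact Commute.zero_left _
  · rintro ⟨m, n⟩; exact ⟨_, _, fun Φ => creA_apply Φ m n⟩
  · exact fun x => ⟨x, 0, fun Φ => by simp⟩

theorem expPair_mul_creB (t : ℂ) : expPair t * creB = creB * expPair t := by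
  have := expPair_mul_of_commutator t (T := creB) (c := 0) ?_ ?_ ?_ ?_
  · simpa using this
  · rw [add_zero]
    exact ((commute_creA_creB.symm).mul_right (Commute.refl _)).eq
  · exact Commute.zero_left _
  · rintro ⟨m, n⟩; exact ⟨_, _, fun Φ => creB_apply Φ m n⟩
  · exact fun x => ⟨x, 0, fun Φ => by simp⟩

theorem commute_expPair_pair (t : ℂ) : Commute (expPair t) (creA * creB) := by
  rw [commute_iff_eq, ← mul_assoc, expPair_mul_creA, mul_assoc, expPair_mul_creB, mul_assoc]

/-- In the Cauchy product, the terms with `i + j = k` add up to `(t - t) ^ k / k!`, which is zero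
unless `k = 0`. -/
theorem expPair_mul_expPair_neg (t : ℂ) : expPair t * expPair (-t) = 1 := by
  ext Φ x
  set N := x.1 + x.2 + 1 with hN
  set f : ℕ → ℂ := fun j => ((creA * creB) ^ j) Φ x with hf
  have step : (expPair t * expPair (-t)) Φ x = ∑ i ∈ Finset.range N, ∑ j ∈ Finset.range N,
      t ^ i / (i.factorial : ℂ) * ((-t) ^ j / (j.factorial : ℂ)) * f (i + j) := by
    rw [Module.End.mul_apply, expPair_apply_of_lt t _ x N (by omega)]
    refine Finset.sum_congr rfl fun i _ => ?_
    have e : ((creA * creB) ^ i) (expPair (-t) Φ) = expPair (-t) (((creA * creB) ^ i) Φ) := by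
      rw [← Module.End.mul_apply, ← ((commute_expPair_pair (-t)).pow_right i).eq]
      rfl
    rw [e, expPair_apply_of_lt (-t) _ x N (by omega), Finset.mul_sum]
    refine Finset.sum_congr rfl fun j _ => ?_
    rw [← Module.End.mul_apply, ← pow_add, add_comm j i]
    ring
  have vanish : ∀ k, N ≤ k → f k = 0 := fun k hk => pair_pow_apply_eq_zero Φ k x (by omega)
  have diag : ∀ k, ∑ q ∈ Finset.HasAntidiagonal.antidiagonal k,
      t ^ q.1 / (q.1.factorial : ℂ) * ((-t) ^ q.2 / (q.2.factorial : ℂ)) * f (q.1 + q.2) =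
      if k = 0 then f 0 else 0 := by
    intro k
    have hk : ∑ q ∈ Finset.HasAntidiagonal.antidiagonal k,
        t ^ q.1 / (q.1.factorial : ℂ) * ((-t) ^ q.2 / (q.2.factorial : ℂ)) =
        (t + -t) ^ k / (k.factorial : ℂ) := by
      rw [add_pow, ← Finset.Nat.sum_antidiagonal_eq_sum_range_succ
        (fun i j => t ^ i * (-t) ^ j * (k.choose i : ℂ)), Finset.sum_div]
      refine Finset.sum_congr rfl fun q hq => ?_
      rw [Finset.HasAntidiagonal.mem_antidiagonal] at hq
      have h0 : (k.factorial : ℂ) ≠ 0 := by exact_mod_cast k.factorial_ne_zero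
      have h1 : (q.1.factorial : ℂ) ≠ 0 := by exact_mod_cast q.1.factorial_ne_zero
      have h2 : (q.2.factorial : ℂ) ≠ 0 := by exact_mod_cast q.2.factorial_ne_zero
      have h3 : (k.choose q.1 : ℂ) * q.1.factorial * q.2.factorial = k.factorial := by
        have := Nat.choose_mul_factorial_mul_factorial (show q.1 ≤ k by omega)
        rw [show k - q.1 = q.2 by omega] at this
        exact_mod_cast this
      field_simp
      linear_combination -t ^ q.1 * (-t) ^ q.2 * h3
    calc _ = (∑ q ∈ Finset.HasAntidiagonal.antidiagonal k,
          t ^ q.1 / (q.1.factorial : ℂ) * ((-t) ^ q.2 / (q.2.factorial : ℂ))) * f k := by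
          rw [Finset.sum_mul]
          refine Finset.sum_congr rfl fun q hq => ?_
          rw [Finset.HasAntidiagonal.mem_antidiagonal.1 hq]
      _ = _ := by
          rw [hk, add_neg_cancel]
          rcases eq_or_ne k 0 with rfl | h
          · simp
          · simp [h]
  rw [step, ← Finset.sum_product', Module.End.one_apply]
  have maps : ∀ q ∈ Finset.range N ×ˢ Finset.range N, q.1 + q.2 ∈ Finset.range (2 * N) := by
    intro q hq
    simp only [Finset.mem_product, Finset.mem_range] at hq ⊢
    omega
  rw [← Finset.sum_fiberwise_of_maps_to maps]
  -- For `k < N` the square contains the whole antidiagonal. For `k ≥ N` it may be truncated, but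
  -- each term contains a vanishing power.
  calc _ = ∑ k ∈ Finset.range (2 * N), if k = 0 then f 0 else 0 := by
        refine Finset.sum_congr rfl fun k _ => ?_
        rcases lt_or_ge k N with hk | hk
        · rw [← diag k]
          refine Finset.sum_congr ?_ fun _ _ => rfl
          ext q
          simp only [Finset.mem_filter, Finset.mem_product, Finset.mem_range,
            Finset.HasAntidiagonal.mem_antidiagonal]
          omega
        · rw [if_neg (by omega)]
          refine Finset.sum_eq_zero fun q hq => ?_
          rw [vanish _ (by rw [(Finset.mem_filter.1 hq).2]; exact hk), mul_zero]
    _ = f 0 := by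
        rw [Finset.sum_ite_eq' (Finset.range (2 * N)) 0 fun _ => f 0, if_pos (by simp; omega)]
    _ = Φ x := by simp [hf]

/-- The operator `(a* a + b* b) / 2 + β a b + γ a* b*`. -/
noncomputable def pairOperator (β γ : ℝ) : Module.End ℂ Formal :=
  (1 / 2 : ℂ) • (creA * annA + creB * annB) + (β : ℂ) • (annA * annB) + (γ : ℂ) • (creA * creB)

theorem hamiltonian_eq_pairOperator (y : ℝ) : hamiltonian y = pairOperator y y := by
  rw [hamiltonian, pairOperator, smul_add (y : ℂ)]
  abel

/-- Normal ordering of `(a - α b*) (b - α a*)` produces the constant `-α y`, which the shift in the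
definition cancels, and changes the coefficient of `a* a + b* b` to `1 / 2 - α y`, which the
rescaling returns to `1 / 2`. -/
theorem transformedHamiltonian_eq_pairOperator (y α : ℝ) (hD : 1 - 2 * α * y ≠ 0) :
    transformedHamiltonian y α = pairOperator (y₁ y α) (y₂ y α) := by
  have hD' : (1 - 2 * α * y : ℂ) ≠ 0 := by exact_mod_cast hD
  have hA := expPair_mul_annA α
  have hB := expPair_mul_annB α
  have hA' := expPair_mul_creA α
  have hB' := expPair_mul_creB α
  have e : expPair α * hamiltonian y = ((1 / 2 - α * y : ℂ) • (creA * annA + creB * annB) +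
      (y : ℂ) • (annA * annB) + (y - α + α ^ 2 * y : ℂ) • (creA * creB) -
      (α * y : ℂ) • (1 : Module.End ℂ Formal)) * expPair α := by
    have k1 : expPair α * (creA * annA) = creA * (annA - (α : ℂ) • creB) * expPair α := by
      rw [← mul_assoc, hA', mul_assoc, hA, mul_assoc]
    have k2 : expPair α * (creB * annB) = creB * (annB - (α : ℂ) • creA) * expPair α := by
      rw [← mul_assoc, hB', mul_assoc, hB, mul_assoc]
    have k3 : expPair α * (creA * creB) = creA * creB * expPair α := commute_expPair_pair _
    have k4 : expPair α * (annA * annB) =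
        (annA - (α : ℂ) • creB) * (annB - (α : ℂ) • creA) * expPair α := by
      rw [← mul_assoc, hA, mul_assoc, hB, mul_assoc]
    rw [hamiltonian, mul_add, mul_smul_comm, mul_smul_comm, mul_add, mul_add, k1, k2, k3, k4,
      ← add_mul, ← add_mul, ← smul_mul_assoc, ← smul_mul_assoc, ← add_mul]
    congr 1
    simp only [mul_sub, sub_mul, mul_smul_comm, smul_mul_assoc, annA_mul_creA,
      commute_creA_creB.symm.eq]
    module
  rw [transformedHamiltonian, e, mul_assoc _ (expPair (α : ℂ)), expPair_mul_expPair_neg,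
    mul_one, pairOperator, y₁, y₂]
  push_cast
  have c1 : (1 / (1 - 2 * α * y) : ℂ) * (1 / 2 - α * y) = 1 / 2 := by
    field_simp
  rw [sub_add_cancel, smul_add, smul_add, smul_smul, smul_smul, smul_smul, c1]
  congr 2
  · congr 1; ring
  · rw [one_div_mul_eq_div]

theorem pairOperator_apply (β γ : ℝ) (Φ : Formal) (m n : ℕ) :
    pairOperator β γ Φ (m, n) = ((m : ℂ) + n) / 2 * Φ (m, n) +
      β * ((√((m : ℝ) + 1) : ℂ) * (√((n : ℝ) + 1) : ℂ) * Φ (m + 1, n + 1)) +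
      γ * ((√(m : ℝ) : ℂ) * (√(n : ℝ) : ℂ) * Φ (m - 1, n - 1)) := by
  have h : pairOperator β γ Φ (m, n) =
      (1 / 2 : ℂ) * ((creA * annA) Φ (m, n) + (creB * annB) Φ (m, n)) +
        β * ((annA * annB) Φ (m, n)) + γ * ((creA * creB) Φ (m, n)) := rfl
  rw [h, creA_annA_apply, creB_annB_apply]
  simp only [Module.End.mul_apply, annA_apply, annB_apply, creA_apply, creB_apply]
  ring

/-- Membership in the maximal domain is automatic, because `E • Ψ` lies in Fock space. -/
theorem isEigenstate_realize_iff (T : Module.End ℂ Formal) (E : ℂ) (Ψ : Fock) :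
    IsEigenstate (realize T) E Ψ ↔ Ψ ≠ 0 ∧ ∀ x, T (Ψ : Formal) x = E * Ψ x := by
  refine and_congr_right fun _ => ⟨?_, fun h => ?_⟩
  · rintro ⟨hd, h⟩ x
    have := congrArg (fun Φ : Fock => (Φ : Formal) x) h
    exact this
  · have hT : T (Ψ : Formal) = ((E • Ψ : Fock) : Formal) := funext h
    have hm : Ψ ∈ (realize T).domain := by
      change Memℓp (T (Ψ : Formal)) 2
      rw [hT]
      exact lp.memℓp (E • Ψ)
    exact ⟨hm, Subtype.ext hT⟩

/-! ### The recurrence on a fibre -/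

/-- The three-term recurrence for the rescaled coefficients of an eigenvector on a fibre. -/
def IsFibreSolution (β γ : ℝ) (p : ℕ) (E : ℂ) (C : ℕ → ℂ) : Prop :=
  ∀ s : ℕ, ((p : ℂ) / 2 + s - E) * C s + γ * (s * C (s - 1)) + β * ((p + s + 1) * C (s + 1)) = 0

theorem pairOperator_apply_fibre (β γ : ℝ) {p : ℕ} {ι : ℕ → ℕ × ℕ}
    (hι : ι = fibrePos p ∨ ι = fibreNeg p) (Φ : Formal) (s : ℕ) :
    pairOperator β γ Φ (ι s) = ((p : ℂ) / 2 + s) * Φ (ι s) +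
      β * ((√((p : ℝ) + s + 1) : ℂ) * (√((s : ℝ) + 1) : ℂ) * Φ (ι (s + 1))) +
      γ * ((√((p : ℝ) + s) : ℂ) * (√(s : ℝ) : ℂ) * Φ (ι (s - 1))) := by
  rcases s with _ | s
  · rcases hι with rfl | rfl
    · simp only [fibrePos, pairOperator_apply]
      push_cast; simp
    · simp only [fibreNeg, pairOperator_apply]
      push_cast; simp
  · rcases hι with rfl | rfl
    · simp only [fibrePos, pairOperator_apply]
      push_cast
      simp only [← add_assoc, Nat.add_sub_cancel]
      ring
    · simp only [fibreNeg, pairOperator_apply]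
      push_cast
      simp only [← add_assoc, Nat.add_sub_cancel]
      ring

/-- The weight `√(s! / (p + s)!)` of the rescaled coefficients. -/
noncomputable def fibreWeight (p s : ℕ) : ℝ := √((s.factorial : ℝ) / ((p + s).factorial : ℝ))

theorem fibreWeight_pos (p s : ℕ) : 0 < fibreWeight p s := by
  unfold fibreWeight
  positivity

theorem fibreWeight_le_one (p s : ℕ) : fibreWeight p s ≤ 1 := by
  unfold fibreWeight
  rw [Real.sqrt_le_one, div_le_one (by positivity)]
  exact_mod_cast Nat.factorial_le (by omega)

theorem fibreWeight_succ (p s : ℕ) :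
    fibreWeight p (s + 1) * √((p : ℝ) + s + 1) = fibreWeight p s * √((s : ℝ) + 1) := by
  unfold fibreWeight
  rw [← Real.sqrt_mul (by positivity), ← Real.sqrt_mul (by positivity)]
  congr 1
  rw [Nat.factorial_succ, ← add_assoc, Nat.factorial_succ]
  push_cast
  field_simp

theorem fibreWeight_mul_sqrt (p s : ℕ) :
    fibreWeight p s * (√((p : ℝ) + s + 1) * √((s : ℝ) + 1)) =
      (p + s + 1) * fibreWeight p (s + 1) := by
  have h := fibreWeight_succ p s
  have h2 := Real.mul_self_sqrt (show 0 ≤ (p : ℝ) + s + 1 by positivity)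
  linear_combination -√((p : ℝ) + s + 1) * h + fibreWeight p (s + 1) * h2

theorem fibreWeight_succ_mul_sqrt (p s : ℕ) :
    fibreWeight p (s + 1) * (√((p : ℝ) + s + 1) * √((s : ℝ) + 1)) =
      (s + 1) * fibreWeight p s := by
  have h := fibreWeight_succ p s
  have h2 := Real.mul_self_sqrt (show 0 ≤ (s : ℝ) + 1 by positivity)
  linear_combination √((s : ℝ) + 1) * h + fibreWeight p s * h2

/-- The weight `√(s! / (p + s)!)` is the one that clears the square roots, leaving coefficients
polynomial in `s`. -/
theorem fibre_equation_iff (β γ : ℝ) {p : ℕ} {ι : ℕ → ℕ × ℕ}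
    (hι : ι = fibrePos p ∨ ι = fibreNeg p) (E : ℂ) (Φ : Formal) :
    (∀ s, pairOperator β γ Φ (ι s) = E * Φ (ι s)) ↔
      IsFibreSolution β γ p E fun s => (fibreWeight p s : ℂ) * Φ (ι s) := by
  refine forall_congr' fun s => ?_
  have hw : (fibreWeight p s : ℂ) ≠ 0 := by exact_mod_cast (fibreWeight_pos p s).ne'
  rw [pairOperator_apply_fibre β γ hι, ← sub_eq_zero, ← mul_right_inj' hw, mul_zero]
  refine Eq.congr ?_ rfl
  have e1 := congrArg (fun x : ℝ => (x : ℂ)) (fibreWeight_mul_sqrt p s)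
  push_cast at e1
  rcases s with _ | s
  · simp only [Nat.cast_zero, Real.sqrt_zero] at e1 ⊢
    push_cast at e1 ⊢
    linear_combination (β * Φ (ι (0 + 1))) * e1
  · have e2 := congrArg (fun x : ℝ => (x : ℂ)) (fibreWeight_succ_mul_sqrt p s)
    push_cast at e1 e2 ⊢
    simp only [← add_assoc] at e1 e2 ⊢
    linear_combination (β * Φ (ι (s + 1 + 1))) * e1 + (γ * Φ (ι s)) * e2

/-- The coefficient `β (p + s + 1)` of `C (s + 1)` never vanishes, so the recurrence is determined
by `C 0`. -/
theorem IsFibreSolution.eq_zero {β γ : ℝ} (hβ : 0 < β) {p : ℕ} {E : ℂ} {C : ℕ → ℂ}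
    (h : IsFibreSolution β γ p E C) (h0 : C 0 = 0) (s : ℕ) : C s = 0 := by
  induction s using Nat.strong_induction_on with
  | _ s ih =>
    rcases s with _ | s
    · exact h0
    · have := h s
      rw [ih s (by omega), ih (s - 1) (by omega)] at this
      have hb : (β : ℂ) ≠ 0 := by exact_mod_cast hβ.ne'
      have hp : ((p : ℂ) + s + 1) ≠ 0 := by exact_mod_cast (p + s).succ_ne_zero
      simpa [hb, hp] using this

theorem exists_fibre (x : ℕ × ℕ) :
    ∃ (p : ℕ) (ι : ℕ → ℕ × ℕ) (s : ℕ), (ι = fibrePos p ∨ ι = fibreNeg p) ∧ ι s = x := by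
  rcases le_total x.2 x.1 with h | h
  · exact ⟨x.1 - x.2, _, x.2, Or.inl rfl, Prod.ext (by simp [fibrePos]; omega) rfl⟩
  · exact ⟨x.2 - x.1, _, x.1, Or.inr rfl, Prod.ext rfl (by simp [fibreNeg]; omega)⟩

/-! ### Parameters -/

/-- The roots `b < -1 < a < 0` of `γ z ^ 2 + z + β`, where `γ > 0`. -/
structure IsRootPair (β γ a b : ℝ) : Prop where
  pos : 0 < γ
  sum : γ * (a + b) = -1
  prod : γ * (a * b) = β
  neg_one_lt : -1 < a
  neg : a < 0
  lt_neg_one : b < -1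

/-- The critical value is the smaller root `c` of `y (1 + c ^ 2) = c`; the roots have product 1. -/
theorem alphaC_spec {y : ℝ} (hy₀ : 0 < y) (hy₁ : y < 1 / 2) :
    0 < √(1 - 4 * y ^ 2) ∧ 2 * y * alphaC y = 1 - √(1 - 4 * y ^ 2) ∧
      y * (1 + alphaC y ^ 2) = alphaC y ∧ 0 < alphaC y ∧ alphaC y < 1 := by
  have hk2 : √(1 - 4 * y ^ 2) ^ 2 = 1 - 4 * y ^ 2 := Real.sq_sqrt (by nlinarith)
  have hk : 0 < √(1 - 4 * y ^ 2) := Real.sqrt_pos.2 (by nlinarith)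
  have h1 : 2 * y * alphaC y = 1 - √(1 - 4 * y ^ 2) := by
    unfold alphaC; field_simp
  set k := √(1 - 4 * y ^ 2)
  set c := alphaC y
  have hc2 : y * (1 + c ^ 2) = c := by
    have : 4 * y * (y * (1 + c ^ 2) - c) = 0 := by
      linear_combination (2 * y * c + 1 - k - 2) * h1 + hk2
    have := (mul_eq_zero.1 this).resolve_left (by positivity)
    linarith
  have hk1 : k < 1 := by nlinarith
  have hk3 : 1 - 2 * y < k := by nlinarith
  exact ⟨hk, h1, hc2, by nlinarith, by nlinarith⟩

theorem one_sub_two_mul_pos {y α : ℝ} (hy₀ : 0 < y) (hy₁ : y < 1 / 2) (hα₁ : α < alphaC y) :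
    0 < 1 - 2 * α * y := by
  obtain ⟨_, _, _, _, _⟩ := alphaC_spec hy₀ hy₁
  nlinarith

/-- After multiplication by `1 + c ^ 2`, with `c = α_c`, the numerator factors as `(c - α) (1 - α
c)`. The second bound, which reduces to `c - α < 1`, is what puts `z₋` below `-1`. -/
theorem y₂_numerator_bounds {y α : ℝ} (hy₀ : 0 < y) (hy₁ : y < 1 / 2) (hα₀ : 0 ≤ α)
    (hα₁ : α < alphaC y) : 0 < y - α + α ^ 2 * y ∧
      2 * (y - α + α ^ 2 * y) < 1 - 2 * α * y + √(1 - 4 * y ^ 2) := by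
  obtain ⟨hk, h1, h2, h3, h4⟩ := alphaC_spec hy₀ hy₁
  set k := √(1 - 4 * y ^ 2)
  set c := alphaC y
  have e1 : (1 + c ^ 2) * (y - α + α ^ 2 * y) = (c - α) * (1 - α * c) := by
    linear_combination (1 + α ^ 2) * h2
  have e2 : (1 + c ^ 2) * (1 - 2 * α * y + k) = 2 * (1 - α * c) := by
    linear_combination (1 + c ^ 2) * h1 + (-2 * α - 2 * c) * h2
  have h5 : 0 < 1 - α * c := by nlinarith
  have h6 : 0 < 1 + c ^ 2 := by positivity
  constructor
  · have : 0 < (1 + c ^ 2) * (y - α + α ^ 2 * y) := by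
      rw [e1]; exact mul_pos (by linarith) h5
    exact (mul_pos_iff_of_pos_left h6).1 this
  · refine lt_of_mul_lt_mul_left ?_ h6.le
    rw [e2]
    nlinarith

theorem discriminant {y α : ℝ} (hy₀ : 0 < y) (hy₁ : y < 1 / 2) (hα₁ : α < alphaC y) :
    √(1 - 4 * y₁ y α * y₂ y α) = √(1 - 4 * y ^ 2) / (1 - 2 * α * y) := by
  have hD := one_sub_two_mul_pos hy₀ hy₁ hα₁
  have h1 : y₁ y α * (1 - 2 * α * y) = y := div_mul_cancel₀ _ hD.ne'
  have h2 : y₂ y α * (1 - 2 * α * y) = y - α + α ^ 2 * y := div_mul_cancel₀ _ hD.ne'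
  have h3 : 1 - 4 * y₁ y α * y₂ y α = (1 - 4 * y ^ 2) / (1 - 2 * α * y) ^ 2 := by
    rw [eq_div_iff (pow_ne_zero 2 hD.ne')]
    linear_combination -4 * y₂ y α * (1 - 2 * α * y) * h1 - 4 * y * h2
  rw [h3, Real.sqrt_div (by nlinarith), Real.sqrt_sq hD.le]

theorem gap_eq {y α : ℝ} (hy₀ : 0 < y) (hy₁ : y < 1 / 2) (hα₀ : 0 ≤ α) (hα₁ : α < alphaC y) :
    y₂ y α * (zPlus y α - zMinus y α) = √(1 - 4 * y ^ 2) / (1 - 2 * α * y) := by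
  have hγ : 0 < y₂ y α :=
    div_pos (y₂_numerator_bounds hy₀ hy₁ hα₀ hα₁).1 (one_sub_two_mul_pos hy₀ hy₁ hα₁)
  rw [← discriminant hy₀ hy₁ hα₁, zPlus, zMinus]
  field_simp
  ring

theorem isRootPair {y α : ℝ} (hy₀ : 0 < y) (hy₁ : y < 1 / 2) (hα₀ : 0 ≤ α)
    (hα₁ : α < alphaC y) (hz : |zPlus y α| < 1) :
    IsRootPair (y₁ y α) (y₂ y α) (zPlus y α) (zMinus y α) := by
  have hD := one_sub_two_mul_pos hy₀ hy₁ hα₁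
  obtain ⟨hn, hb⟩ := y₂_numerator_bounds hy₀ hy₁ hα₀ hα₁
  have hγ : 0 < y₂ y α := div_pos hn hD
  have hβ : 0 < y₁ y α := div_pos hy₀ hD
  have hs := discriminant hy₀ hy₁ hα₁
  have hκ := (alphaC_spec hy₀ hy₁).1
  have hs0 : 0 < √(1 - 4 * y₁ y α * y₂ y α) := by rw [hs]; positivity
  have hs2 := Real.sq_sqrt (Real.sqrt_pos.1 hs0).le
  have hγD : y₂ y α * (1 - 2 * α * y) = y - α + α ^ 2 * y := div_mul_cancel₀ _ hD.ne'
  have hsD : √(1 - 4 * y₁ y α * y₂ y α) * (1 - 2 * α * y) = √(1 - 4 * y ^ 2) := by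
    rw [hs, div_mul_cancel₀ _ hD.ne']
  have ha : zPlus y α = (-1 + √(1 - 4 * y₁ y α * y₂ y α)) / (2 * y₂ y α) := rfl
  have hb' : zMinus y α = (-1 - √(1 - 4 * y₁ y α * y₂ y α)) / (2 * y₂ y α) := rfl
  set s := √(1 - 4 * y₁ y α * y₂ y α)
  set β := y₁ y α
  set γ := y₂ y α
  have hβγ : 0 < β * γ := mul_pos hβ hγ
  refine ⟨hγ, ?_, ?_, (abs_lt.1 hz).1, ?_, ?_⟩
  · rw [ha, hb']; field_simp; ring
  · rw [ha, hb']; field_simp; linear_combination -hs2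
  · rw [ha]
    exact div_neg_of_neg_of_pos (by nlinarith) (by positivity)
  · rw [hb', div_lt_iff₀ (by positivity)]
    have : 2 * γ < 1 + s := by
      refine lt_of_mul_lt_mul_right ?_ hD.le
      linarith
    linarith

/-- At `α = 0` the root `z₊` is `-α_c`. This makes the general spectrum theorem available for the
original Hamiltonian. -/
theorem abs_zPlus_zero_lt {y : ℝ} (hy₀ : 0 < y) (hy₁ : y < 1 / 2) : |zPlus y 0| < 1 := by
  obtain ⟨_, h1, _, h3, h4⟩ := alphaC_spec hy₀ hy₁
  have hs := discriminant hy₀ hy₁ h3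
  have : zPlus y 0 = -alphaC y := by
    rw [zPlus, hs]
    unfold y₂ alphaC
    field_simp
    simp only [mul_zero, sub_zero, ne_eq, OfNat.ofNat_ne_zero, not_false_eq_true, zero_pow,
      add_zero]
    field_simp
    ring
  rw [this, abs_neg, abs_of_pos h3]
  exact h4

theorem IsRootPair.β_pos {β γ a b : ℝ} (h : IsRootPair β γ a b) : 0 < β := by
  rw [← h.prod]
  exact mul_pos h.pos (mul_pos_of_neg_of_neg h.neg (by linarith [h.lt_neg_one]))

theorem IsRootPair.gap_pos {β γ a b : ℝ} (h : IsRootPair β γ a b) : 0 < γ * (a - b) :=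
  mul_pos h.pos (by linarith [h.lt_neg_one, h.neg_one_lt])

/-! ### Analytic solutions of the differential equation -/

/-- This is the partial fraction expansion of `n! / (x (x + 1) ⋯ (x + n))`, by induction through
Pascal's rule. It shows that a particular solution does not vanish at the origin. -/
theorem sum_choose_div_add (n : ℕ) : ∀ x : ℂ, (∀ k : ℕ, k ≤ n → x + k ≠ 0) →
    ∑ k ∈ Finset.range (n + 1), (-1) ^ k * (n.choose k : ℂ) / (x + k) =
      n.factorial / ∏ k ∈ Finset.range (n + 1), (x + k) := by
  induction n with
  | zero => intro x _; simp
  | succ n ih =>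
    intro x hx
    have h1 := ih x fun k hk => hx k (by omega)
    have hx' : ∀ k : ℕ, k ≤ n → x + 1 + k ≠ 0 := fun k hk => by
      have := hx (k + 1) (by omega)
      push_cast at this
      rwa [add_right_comm, add_assoc]
    have h2 := ih (x + 1) hx'
    have split : ∑ k ∈ Finset.range (n + 1 + 1), (-1) ^ k * ((n + 1).choose k : ℂ) / (x + k) =
        ∑ k ∈ Finset.range (n + 1), (-1) ^ k * (n.choose k : ℂ) / (x + k) -
        ∑ k ∈ Finset.range (n + 1), (-1) ^ k * (n.choose k : ℂ) / (x + 1 + k) := by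
      rw [Finset.sum_range_succ']
      have e : ∑ k ∈ Finset.range (n + 1), (-1) ^ k * (n.choose k : ℂ) / (x + k) =
          ∑ k ∈ Finset.range (n + 1),
            (-1) ^ (k + 1) * (n.choose (k + 1) : ℂ) / (x + (k + 1 : ℕ)) +
            (-1) ^ 0 * (n.choose 0 : ℂ) / (x + (0 : ℕ)) := by
        rw [← Finset.sum_range_succ' (fun k => (-1) ^ k * (n.choose k : ℂ) / (x + k)),
          Finset.sum_range_succ _ (n + 1), Nat.choose_succ_self]
        simp
      rw [e, add_sub_right_comm, ← Finset.sum_sub_distrib]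
      congr 1
      · refine Finset.sum_congr rfl fun k _ => ?_
        rw [Nat.choose_succ_succ]
        push_cast
        rw [show x + ((k : ℂ) + 1) = x + 1 + k by ring]
        ring
      · simp
    rw [split, h1, h2]
    have p1 := Finset.prod_range_succ' (fun k : ℕ => x + (k : ℂ)) (n + 1)
    have p2 := Finset.prod_range_succ (fun k : ℕ => x + (k : ℂ)) (n + 1)
    have e : ∏ k ∈ Finset.range (n + 1), (x + ((k + 1 : ℕ) : ℂ)) =
        ∏ k ∈ Finset.range (n + 1), (x + 1 + k) :=
      Finset.prod_congr rfl fun k _ => by push_cast; ring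
    rw [e] at p1
    have n1 : ∏ k ∈ Finset.range (n + 1), (x + (k : ℂ)) ≠ 0 :=
      Finset.prod_ne_zero_iff.2 fun k hk => hx k (by simp at hk; omega)
    have n2 : ∏ k ∈ Finset.range (n + 1), (x + 1 + (k : ℂ)) ≠ 0 :=
      Finset.prod_ne_zero_iff.2 fun k hk => hx' k (by simp at hk; omega)
    have n3 : ∏ k ∈ Finset.range (n + 1 + 1), (x + (k : ℂ)) ≠ 0 :=
      Finset.prod_ne_zero_iff.2 fun k hk => hx k (by simp at hk; omega)
    have hx0 : x ≠ 0 := by simpa using hx 0 (by omega)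
    have hxn : x + ((n + 1 : ℕ) : ℂ) ≠ 0 := hx (n + 1) le_rfl
    rw [div_sub_div _ _ n1 n2, div_eq_div_iff (mul_ne_zero n1 n2) n3, Nat.factorial_succ]
    set P := ∏ k ∈ Finset.range (n + 1), (x + (k : ℂ))
    set Q := ∏ k ∈ Finset.range (n + 1), (x + 1 + (k : ℂ))
    set R := ∏ k ∈ Finset.range (n + 1 + 1), (x + (k : ℂ))
    push_cast at p1 p2 ⊢
    linear_combination (n.factorial : ℂ) * Q * p2 - (n.factorial : ℂ) * P * p1

/-- The Fuchsian operator `(z - a) (z - b) F' - (B (z - b) + (ν - B) (z - a)) F`. -/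
noncomputable def fuchsOp (a b B ν : ℂ) (F : ℂ → ℂ) (z : ℂ) : ℂ :=
  (z - a) * (z - b) * deriv F z - (B * (z - b) + (ν - B) * (z - a)) * F z

theorem fuchsOp_sub {a b B ν : ℂ} {F G : ℂ → ℂ} {z : ℂ} (hF : DifferentiableAt ℂ F z)
    (hG : DifferentiableAt ℂ G z) :
    fuchsOp a b B ν (fun z => F z - G z) z = fuchsOp a b B ν F z - fuchsOp a b B ν G z := by
  rw [fuchsOp, fuchsOp, fuchsOp, deriv_fun_sub hF hG]
  ring

/-- The eigenfunctions `(z - a) ^ k (z - b) ^ (n - k)` of `fuchsOp`. -/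
theorem fuchsOp_basis (a b B : ℂ) {n k : ℕ} (hk : k ≤ n) (z : ℂ) :
    fuchsOp a b B n (fun z => (z - a) ^ k * (z - b) ^ (n - k)) z =
      (k - B) * (a - b) * ((z - a) ^ k * (z - b) ^ (n - k)) := by
  have h1 : HasDerivAt (fun z : ℂ => (z - a) ^ k) (k * (z - a) ^ (k - 1) * 1) z :=
    ((hasDerivAt_id z).sub_const a).pow k
  have h2 : HasDerivAt (fun z : ℂ => (z - b) ^ (n - k))
      ((n - k : ℕ) * (z - b) ^ (n - k - 1) * 1) z := ((hasDerivAt_id z).sub_const b).pow (n - k)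
  have key : ∀ (j : ℕ) (u : ℂ), u * (j * u ^ (j - 1)) = j * u ^ j := by
    intro j u
    rcases j with _ | j
    · simp
    · rw [Nat.add_sub_cancel, pow_succ]; ring
  rw [fuchsOp, (h1.fun_mul h2).deriv]
  have k1 := key k (z - a)
  have k2 := key (n - k) (z - b)
  have k3 : ((n - k : ℕ) : ℂ) = n - k := by push_cast [hk]; ring
  rw [k3] at k2 ⊢
  linear_combination (z - b) * (z - b) ^ (n - k) * k1 + (z - a) * (z - a) ^ k * k2

/-- Since `(a - b) z = -b (z - a) + a (z - b)`, this is the binomial theorem. -/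
theorem pow_eq_sum_basis {a b : ℂ} (hab : a ≠ b) (n : ℕ) (z : ℂ) :
    z ^ n = ∑ k ∈ Finset.range (n + 1),
      ((-b) ^ k * a ^ (n - k) * (n.choose k : ℂ) / (a - b) ^ n) *
        ((z - a) ^ k * (z - b) ^ (n - k)) := by
  have h : a - b ≠ 0 := sub_ne_zero.2 hab
  have : z = (-b * (z - a) + a * (z - b)) / (a - b) := by field_simp; ring
  conv_lhs => rw [this, div_pow, add_pow, Finset.sum_div]
  refine Finset.sum_congr rfl fun k _ => ?_
  rw [mul_pow, mul_pow]
  ring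

/-- The leading term at `a` of the image under `fuchsOp` of a function with leading term
`g a * (z - a) ^ k`. -/
theorem fuchsOp_leading {a b B ν : ℂ} {k : ℕ} {h g : ℂ → ℂ} (hg : AnalyticAt ℂ g a)
    (hh : ∀ᶠ z in 𝓝 a, h z = (z - a) ^ k * g z) :
    ∃ R : ℂ → ℂ, ContinuousAt R a ∧ R a = (k - B) * (a - b) * g a ∧
      ∀ᶠ z in 𝓝 a, fuchsOp a b B ν h z = (z - a) ^ k * R z := by
  refine ⟨fun z => (k - B) * (z - b) * g z + (z - a) * ((z - b) * deriv g z - (ν - B) * g z),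
    ?_, by simp, ?_⟩
  · have h1 := hg.continuousAt
    have h2 := hg.deriv.continuousAt
    fun_prop
  · filter_upwards [hh.eventually_nhds, hg.eventually_analyticAt] with z hz hgz
    have h1 : HasDerivAt (fun z : ℂ => (z - a) ^ k) (k * (z - a) ^ (k - 1) * 1) z :=
      ((hasDerivAt_id z).sub_const a).pow k
    have h2 : deriv h z = k * (z - a) ^ (k - 1) * 1 * g z + (z - a) ^ k * deriv g z := by
      rw [Filter.EventuallyEq.deriv_eq hz]
      exact (h1.fun_mul hgz.differentiableAt.hasDerivAt).deriv
    have key : (z - a) * (k * (z - a) ^ (k - 1)) = k * (z - a) ^ k := by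
      rcases k with _ | j
      · simp
      · rw [Nat.add_sub_cancel, pow_succ]; ring
    rw [fuchsOp, h2, Filter.Eventually.self_of_nhds hz]
    linear_combination (z - b) * g z * key

theorem eq_of_pow_mul_eventuallyEq {a : ℂ} {k : ℕ} {R S : ℂ → ℂ} (hR : ContinuousAt R a)
    (hS : ContinuousAt S a) (h : ∀ᶠ z in 𝓝 a, (z - a) ^ k * R z = (z - a) ^ k * S z) :
    R a = S a := by
  have h1 : ∀ᶠ z in 𝓝[≠] a, R z = S z := by
    filter_upwards [h.filter_mono nhdsWithin_le_nhds, self_mem_nhdsWithin] with z hz hne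
    exact mul_left_cancel₀ (pow_ne_zero k (sub_ne_zero.2 hne)) hz
  have l1 : Tendsto R (𝓝[≠] a) (𝓝 (R a)) := hR.tendsto.mono_left nhdsWithin_le_nhds
  have l2 : Tendsto S (𝓝[≠] a) (𝓝 (S a)) := hS.tendsto.mono_left nhdsWithin_le_nhds
  exact tendsto_nhds_unique (l1.congr' h1) l2

/-- An analytic solution of the homogeneous equation that does not vanish identically near `a`
forces a natural exponent. -/
theorem exponent_of_homogeneous {a b B ν : ℂ} (hab : a ≠ b) {h : ℂ → ℂ}
    (hh : AnalyticAt ℂ h a) (h0 : ∀ᶠ z in 𝓝 a, fuchsOp a b B ν h z = 0)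
    (hne : ¬ ∀ᶠ z in 𝓝 a, h z = 0) : ∃ m : ℕ, B = m := by
  -- With `k` the order of vanishing at `a`, the leading coefficient `(k - B) (a - b) g a` of the
  -- image must be zero.
  obtain ⟨k, g, hg, hga, hgh⟩ := hh.exists_eventuallyEq_pow_smul_nonzero_iff.2 hne
  obtain ⟨R, hRc, hRa, hR⟩ := fuchsOp_leading (b := b) (B := B) (ν := ν) hg
    (by simpa only [smul_eq_mul] using hgh)
  have : R a = 0 := by
    refine eq_of_pow_mul_eventuallyEq (k := k) hRc (continuousAt_const (y := (0 : ℂ))) ?_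
    filter_upwards [h0, hR] with z h1 h2
    rw [← h2, h1, mul_zero]
  rw [hRa] at this
  have h3 : (k : ℂ) - B = 0 := by
    simpa [hga, sub_ne_zero.2 hab] using this
  exact ⟨k, by linear_combination -h3⟩

/-- No analytic function is mapped to the resonant monomial. -/
theorem no_resonant_solution {a b : ℂ} (hab : a ≠ b) {n m : ℕ} {h : ℂ → ℂ}
    (hh : AnalyticAt ℂ h a) {q : ℂ} (hq : q ≠ 0)
    (h0 : ∀ᶠ z in 𝓝 a, fuchsOp a b m n h z = q * ((z - a) ^ m * (z - b) ^ (n - m))) : False := by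
  have hab' := sub_ne_zero.2 hab
  by_cases hne : ∀ᶠ z in 𝓝 a, h z = 0
  · have hd : ∀ᶠ z in 𝓝 a, (z - a) ^ m * (q * (z - b) ^ (n - m)) = (z - a) ^ m * 0 := by
      filter_upwards [h0, hne.eventually_nhds] with z h1 h2
      have : deriv h z = 0 := by
        rw [Filter.EventuallyEq.deriv_eq h2]
        simp
      rw [fuchsOp, this, Filter.Eventually.self_of_nhds h2] at h1
      linear_combination -h1
    have := eq_of_pow_mul_eventuallyEq (by fun_prop) continuousAt_const hd
    simp [hq, hab'] at this
  obtain ⟨k, g, hg, hga, hgh⟩ := hh.exists_eventuallyEq_pow_smul_nonzero_iff.2 hne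
  obtain ⟨R, hRc, hRa, hR⟩ := fuchsOp_leading (b := b) (B := m) (ν := n) hg
    (by simpa only [smul_eq_mul] using hgh)
  -- The right side has order exactly `m` at `a`. If `k < m` the image has order `k`, too low; if `k
  -- = m` its leading coefficient vanishes; if `k > m` its order is too high.
  rcases lt_trichotomy k m with hk | rfl | hk
  · have := eq_of_pow_mul_eventuallyEq (k := k) (R := R)
      (S := fun z => (z - a) ^ (m - k) * (q * (z - b) ^ (n - m))) hRc (by fun_prop) (by
        filter_upwards [h0, hR] with z h1 h2
        rw [← h2, h1, ← mul_assoc ((z - a) ^ k), ← pow_add, Nat.add_sub_cancel' hk.le]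
        ring)
    rw [hRa, sub_self, zero_pow (by omega), zero_mul] at this
    have hkm : (k : ℂ) - m ≠ 0 := sub_ne_zero.2 (by exact_mod_cast hk.ne)
    simp [hkm, hab', hga] at this
  · have := eq_of_pow_mul_eventuallyEq (k := k) (R := R)
      (S := fun z => q * (z - b) ^ (n - k)) hRc (by fun_prop) (by
        filter_upwards [h0, hR] with z h1 h2
        rw [← h2, h1]
        ring)
    rw [hRa] at this
    simp [hq, hab'] at this
  · have := eq_of_pow_mul_eventuallyEq (a := a) (k := m) (R := fun z => (z - a) ^ (k - m) * R z)
      (S := fun z => q * (z - b) ^ (n - m)) (by fun_prop) (by fun_prop) (by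
        filter_upwards [h0, hR] with z h1 h2
        rw [← mul_assoc, ← pow_add, Nat.add_sub_cancel' hk.le, ← h2, h1]
        ring)
    rw [sub_self, zero_pow (by omega), zero_mul] at this
    simp [hq, hab'] at this

/-- An analytic solution of the inhomogeneous equation on the unit disk that vanishes at the
origin exists only for natural exponents above `n`. -/
theorem exponent_of_inhomogeneous {a b B K : ℂ} (hab : a ≠ b) (ha : a ≠ 0) (hb : b ≠ 0)
    (ha1 : ‖a‖ < 1) (hK : K ≠ 0) {n : ℕ} {F : ℂ → ℂ}
    (hF : AnalyticOnNhd ℂ F (Metric.ball 0 1)) (hF0 : F 0 = 0)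
    (hode : ∀ z ∈ Metric.ball (0 : ℂ) 1, fuchsOp a b B n F z = K * z ^ n) :
    ∃ m : ℕ, B = m ∧ n + 1 ≤ m := by
  have hab' := sub_ne_zero.2 hab
  have haball : a ∈ Metric.ball (0 : ℂ) 1 := by simpa using ha1
  set q : ℕ → ℂ := fun k => K * ((-b) ^ k * a ^ (n - k) * (n.choose k : ℂ) / (a - b) ^ n) with hq
  have hq0 : ∀ k ≤ n, q k ≠ 0 := fun k hk => by
    have : (n.choose k : ℂ) ≠ 0 := by exact_mod_cast (Nat.choose_pos hk).ne'
    exact mul_ne_zero hK (div_ne_zero (mul_ne_zero (mul_ne_zero (pow_ne_zero _ (neg_ne_zero.2 hb))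
      (pow_ne_zero _ ha)) this) (pow_ne_zero _ hab'))
  set e : ℕ → ℂ → ℂ := fun k z => (z - a) ^ k * (z - b) ^ (n - k) with he
  -- The source is divided by the eigenvalues term by term. If `B = k` is resonant, division by zero
  -- gives 0 and that term is left out, so `F - S` keeps exactly the resonant source.
  set S : ℂ → ℂ := fun z => ∑ k ∈ Finset.range (n + 1), q k / ((k - B) * (a - b)) * e k z with hS
  have hSd : Differentiable ℂ S := by
    simp only [hS, he]
    fun_prop
  have hSop : ∀ z, fuchsOp a b B n S z =
      ∑ k ∈ Finset.range (n + 1), q k / ((k - B) * (a - b)) * ((k - B) * (a - b) * e k z) := by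
    intro z
    have hd : deriv S z = ∑ k ∈ Finset.range (n + 1),
        q k / ((k - B) * (a - b)) * deriv (e k) z := by
      have : ∀ k ∈ Finset.range (n + 1), HasDerivAt (fun z => q k / ((k - B) * (a - b)) * e k z)
          (q k / ((k - B) * (a - b)) * deriv (e k) z) z := by
        intro k _
        refine HasDerivAt.const_mul _ (DifferentiableAt.hasDerivAt ?_)
        simp only [he]
        fun_prop
      exact (HasDerivAt.fun_sum this).deriv
    rw [fuchsOp, hd, hS, Finset.mul_sum, Finset.mul_sum, ← Finset.sum_sub_distrib]
    refine Finset.sum_congr rfl fun k hk => ?_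
    rw [← fuchsOp_basis a b B (show k ≤ n by simp at hk; omega) z, fuchsOp]
    ring
  have hFS : ∀ z ∈ Metric.ball (0 : ℂ) 1, fuchsOp a b B n (fun z => F z - S z) z =
      ∑ k ∈ Finset.range (n + 1),
        (q k - q k / ((k - B) * (a - b)) * ((k - B) * (a - b))) * e k z := by
    intro z hz
    rw [fuchsOp_sub (hF z hz).differentiableAt hSd.differentiableAt, hode z hz, hSop,
      pow_eq_sum_basis hab n z, Finset.mul_sum, ← Finset.sum_sub_distrib]
    refine Finset.sum_congr rfl fun k _ => ?_
    simp only [hq, he]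
    ring
  have hFSa : AnalyticOnNhd ℂ (fun z => F z - S z) (Metric.ball 0 1) := fun z hz =>
    (hF z hz).sub ((hSd.differentiableOn (s := Set.univ)).analyticAt Filter.univ_mem)
  have hball : Metric.ball (0 : ℂ) 1 ∈ 𝓝 a := Metric.isOpen_ball.mem_nhds haball
  have hcancel : ∀ k : ℕ, B ≠ k → q k - q k / ((k - B) * (a - b)) * ((k - B) * (a - b)) = 0 := by
    intro k hk
    have : (k : ℂ) - B ≠ 0 := sub_ne_zero.2 hk.symm
    field_simp
    ring
  by_cases hB : ∃ m : ℕ, B = m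
  · obtain ⟨m, rfl⟩ := hB
    refine ⟨m, rfl, ?_⟩
    by_contra hm
    have hm' : m ≤ n := by omega
    refine no_resonant_solution hab (hFSa a haball) (hq0 m hm') ?_ (n := n) (m := m)
    filter_upwards [hball] with z hz
    rw [hFS z hz, Finset.sum_eq_single_of_mem m (by simp; omega)]
    · simp [he]
    · intro k _ hk
      rw [hcancel k (by exact_mod_cast hk.symm), zero_mul]
  · exfalso
    have hB' : ∀ k : ℕ, B ≠ k := fun k hk => hB ⟨k, hk⟩
    have hhom : ∀ᶠ z in 𝓝 a, fuchsOp a b B n (fun z => F z - S z) z = 0 := by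
      filter_upwards [hball] with z hz
      rw [hFS z hz]
      exact Finset.sum_eq_zero fun k _ => by rw [hcancel k (hB' k), zero_mul]
    have hloc : ∀ᶠ z in 𝓝 a, F z - S z = 0 := by
      by_contra hne
      exact hB (exponent_of_homogeneous hab (hFSa a haball) hhom hne)
    have h00 : F 0 - S 0 = 0 :=
      hFSa.eqOn_zero_of_preconnected_of_eventuallyEq_zero
        (convex_ball (0 : ℂ) 1).isPreconnected haball hloc (Metric.mem_ball_self one_pos)
    -- The value at 0 is a partial fraction sum with `x = -B`, hence nonzero, against `F 0 = 0`.
    have hS0 : S 0 = K * (a ^ n * (-b) ^ n / (a - b) ^ (n + 1)) *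
        ∑ k ∈ Finset.range (n + 1), (-1) ^ k * (n.choose k : ℂ) / (-B + k) := by
      rw [hS, Finset.mul_sum]
      refine Finset.sum_congr rfl fun k hk => ?_
      have hk' : k ≤ n := by simp at hk; omega
      have e1 : a ^ n = a ^ (n - k) * a ^ k := by rw [← pow_add, Nat.sub_add_cancel hk']
      have e2 : (-b) ^ n = (-b) ^ (n - k) * (-b) ^ k := by rw [← pow_add, Nat.sub_add_cancel hk']
      have h1 : (k : ℂ) - B ≠ 0 := sub_ne_zero.2 (hB' k).symm
      have h2 : -B + (k : ℂ) ≠ 0 := by rwa [neg_add_eq_sub]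
      simp only [hq, he]
      rw [e1, e2, zero_sub, zero_sub, neg_pow a, neg_add_eq_sub, pow_succ]
      field_simp
    rw [sum_choose_div_add n (-B) fun k _ h => hB' k (by linear_combination -h)] at hS0
    have : S 0 ≠ 0 := by
      rw [hS0]
      have hp : ∏ k ∈ Finset.range (n + 1), (-B + (k : ℂ)) ≠ 0 :=
        Finset.prod_ne_zero_iff.2 fun k _ h => hB' k (by linear_combination -h)
      have hf : (n.factorial : ℂ) ≠ 0 := by exact_mod_cast n.factorial_ne_zero
      have hb' : -b ≠ 0 := neg_ne_zero.2 hb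
      exact mul_ne_zero (mul_ne_zero hK (div_ne_zero (mul_ne_zero (pow_ne_zero _ ha)
        (pow_ne_zero _ hb')) (pow_ne_zero _ hab'))) (div_ne_zero hf hp)
    apply this
    rw [hF0] at h00
    linear_combination -h00

/-! ### The integral formula and the differential equation -/

/-- Used with exponents `-B`, `B - n` as an integrating factor, and with `B`, `n - B` to
differentiate the integral formula. -/
theorem hasDerivAt_mul_cpow {a b B C F' u : ℂ} {F : ℂ → ℂ} (hF : HasDerivAt F F' u)
    (ha : u - a ∈ Complex.slitPlane) (hb : u - b ∈ Complex.slitPlane) :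
    HasDerivAt (fun u => F u * (u - a) ^ B * (u - b) ^ C)
      (((u - a) * (u - b) * F' + (B * (u - b) + C * (u - a)) * F u) *
        (u - a) ^ (B - 1) * (u - b) ^ (C - 1)) u := by
  have h1 := ((hasDerivAt_id u).sub_const a).cpow_const (c := B) ha
  have h2 := ((hasDerivAt_id u).sub_const b).cpow_const (c := C) hb
  have e1 : (u - a) ^ B = (u - a) ^ (B - 1) * (u - a) := by
    rw [Complex.cpow_sub _ _ (Complex.slitPlane_ne_zero ha), Complex.cpow_one,
      div_mul_cancel₀ _ (Complex.slitPlane_ne_zero ha)]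
  have e2 : (u - b) ^ C = (u - b) ^ (C - 1) * (u - b) := by
    rw [Complex.cpow_sub _ _ (Complex.slitPlane_ne_zero hb), Complex.cpow_one,
      div_mul_cancel₀ _ (Complex.slitPlane_ne_zero hb)]
  refine ((hF.fun_mul h1).fun_mul h2).congr_deriv ?_
  simp only [id, e1, e2]
  ring

/-- Since `a < 0`, the plane cut along `(-∞, a]` is star-shaped about 0. -/
theorem sub_mem_slitPlane_of_segment {a : ℝ} (ha : a < 0) {z : ℂ}
    (hz : z - a ∈ Complex.slitPlane) {t : ℝ} (ht : t ∈ Set.Icc (0 : ℝ) 1) :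
    t * z - a ∈ Complex.slitPlane := by
  rw [Complex.mem_slitPlane_iff] at hz ⊢
  simp only [Complex.sub_re, Complex.ofReal_re, Complex.sub_im, Complex.ofReal_im, sub_zero,
    Complex.re_ofReal_mul, Complex.im_ofReal_mul] at hz ⊢
  obtain ⟨h0, h1⟩ := ht
  rcases h0.eq_or_lt with rfl | h0
  · left; simpa using ha
  · rcases hz with hz | hz
    · left; nlinarith
    · right; exact mul_ne_zero h0.ne' hz

theorem sub_mem_slitPlane_of_norm_lt {a : ℝ} {z : ℂ} (hz : ‖z‖ < -a) :
    z - a ∈ Complex.slitPlane := by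
  rw [Complex.mem_slitPlane_iff]
  left
  have := (abs_le.1 (Complex.abs_re_le_norm z)).1
  simp only [Complex.sub_re, Complex.ofReal_re]
  linarith

theorem norm_ofReal_mul_le {z : ℂ} {t : ℝ} (ht : t ∈ Set.Icc (0 : ℝ) 1) : ‖t * z‖ ≤ ‖z‖ := by
  rw [norm_mul, Complex.norm_real, Real.norm_of_nonneg ht.1]
  exact mul_le_of_le_one_left (norm_nonneg z) ht.2

/-- The integrand of the integral formula. -/
noncomputable def kernelFun (a b : ℝ) (n : ℕ) (B u : ℂ) : ℂ :=
  u ^ n * (u - a) ^ (-(1 + B)) * (u - b) ^ (-(1 + (n - B)))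

/-- The integral formula as a function of the two roots. -/
noncomputable def rootIntegral (a b : ℝ) (n : ℕ) (K B z : ℂ) : ℂ :=
  K * (z - a) ^ B * (z - b) ^ (n - B) * ∫ t in (0 : ℝ)..1, kernelFun a b n B (t * z) * z

theorem differentiableAt_kernelFun {a b : ℝ} {n : ℕ} {B u : ℂ} (ha : u - a ∈ Complex.slitPlane)
    (hb : u - b ∈ Complex.slitPlane) : DifferentiableAt ℂ (kernelFun a b n B) u := by
  have h1 := (((hasDerivAt_id u).sub_const (a : ℂ)).cpow_const
    (c := -(1 + B)) ha).differentiableAt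
  have h2 := (((hasDerivAt_id u).sub_const (b : ℂ)).cpow_const
    (c := -(1 + (n - B))) hb).differentiableAt
  exact ((differentiableAt_id.pow n).mul h1).mul h2

/-- Along a segment from `0` in the slit disk, the integral of the kernel is the increment of a
primitive. -/
theorem integral_kernelFun {a b : ℝ} (ha : a < 0) (hb : b < -1) {n : ℕ} {K B z : ℂ} {P : ℂ → ℂ}
    (hz : ‖z‖ < 1) (hza : z - a ∈ Complex.slitPlane)
    (hP : ∀ u : ℂ, ‖u‖ ≤ ‖z‖ → u - a ∈ Complex.slitPlane → u - b ∈ Complex.slitPlane →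
      HasDerivAt P (K * kernelFun a b n B u) u) :
    K * ∫ t in (0 : ℝ)..1, kernelFun a b n B (t * z) * z = P z - P 0 := by
  have hmem : ∀ t ∈ Set.uIcc (0 : ℝ) 1, ‖(t * z : ℂ)‖ ≤ ‖z‖ ∧ (t * z - a : ℂ) ∈ Complex.slitPlane ∧
      (t * z - b : ℂ) ∈ Complex.slitPlane := by
    intro t ht
    rw [Set.uIcc_of_le zero_le_one] at ht
    exact ⟨norm_ofReal_mul_le ht, sub_mem_slitPlane_of_segment ha hza ht,
      sub_mem_slitPlane_of_norm_lt ((norm_ofReal_mul_le ht).trans_lt (by linarith))⟩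
  have hlin : ∀ t : ℝ, HasDerivAt (fun s : ℂ => s * z) z (t : ℂ) := fun t => by
    simpa using (hasDerivAt_id (t : ℂ)).mul_const z
  have hderiv : ∀ t ∈ Set.uIcc (0 : ℝ) 1, HasDerivAt (fun t : ℝ => P (t * z))
      (K * (kernelFun a b n B (t * z) * z)) t := by
    intro t ht
    obtain ⟨h1, h2, h3⟩ := hmem t ht
    have := ((hP _ h1 h2 h3).comp (t : ℂ) (hlin t)).comp_ofReal
    rw [← mul_assoc]
    exact this
  have hcont : ContinuousOn (fun t : ℝ => K * (kernelFun a b n B (t * z) * z))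
      (Set.uIcc (0 : ℝ) 1) := by
    intro t ht
    obtain ⟨_, h2, h3⟩ := hmem t ht
    have hk := (differentiableAt_kernelFun (n := n) (B := B) h2 h3).continuousAt
    have hc : ContinuousAt (fun t : ℝ => (t * z : ℂ)) t := by fun_prop
    have := ContinuousAt.comp (f := fun t : ℝ => (t * z : ℂ)) hk hc
    exact ((this.mul continuousAt_const).const_mul K |>.continuousWithinAt :)
  rw [← intervalIntegral.integral_const_mul,
    intervalIntegral.integral_eq_sub_of_hasDerivAt hderiv hcont.intervalIntegrable]
  simp

/-- A solution of the differential equation that vanishes at `0` is given by the integral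
formula. -/
theorem eq_rootIntegral {a b : ℝ} (ha : a < 0) (hb : b < -1) {n : ℕ} {K B z : ℂ} {F : ℂ → ℂ}
    (hF : DifferentiableOn ℂ F (Metric.ball 0 1)) (hF0 : F 0 = 0)
    (hode : ∀ z ∈ Metric.ball (0 : ℂ) 1, fuchsOp a b B n F z = K * z ^ n)
    (hz : ‖z‖ < 1) (hza : z - a ∈ Complex.slitPlane) : F z = rootIntegral a b n K B z := by
  have hzb : z - b ∈ Complex.slitPlane := sub_mem_slitPlane_of_norm_lt (by linarith)
  have key := integral_kernelFun (n := n) (K := K) (B := B)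
    (P := fun u => F u * (u - a) ^ (-B) * (u - b) ^ (-((n : ℂ) - B))) ha hb hz hza (by
      intro u hu hua hub
      have hu1 : u ∈ Metric.ball (0 : ℂ) 1 := by simpa using hu.trans_lt hz
      have hd := (hF.differentiableAt (Metric.isOpen_ball.mem_nhds hu1)).hasDerivAt
      refine (hasDerivAt_mul_cpow (B := -B) (C := -((n : ℂ) - B)) hd hua hub).congr_deriv ?_
      have := hode u hu1
      rw [fuchsOp] at this
      rw [kernelFun, show -B - 1 = -(1 + B) by ring,
        show -((n : ℂ) - B) - 1 = -(1 + (n - B)) by ring]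
      linear_combination (u - a) ^ (-(1 + B)) * (u - b) ^ (-(1 + ((n : ℂ) - B))) * this)
  have e1 : (z - a) ^ B * (z - a) ^ (-B) = 1 := by
    rw [Complex.cpow_neg, mul_inv_cancel₀]
    simp [Complex.cpow_eq_zero_iff, Complex.slitPlane_ne_zero hza]
  have e2 : (z - b) ^ ((n : ℂ) - B) * (z - b) ^ (-((n : ℂ) - B)) = 1 := by
    rw [Complex.cpow_neg, mul_inv_cancel₀]
    simp [Complex.cpow_eq_zero_iff, Complex.slitPlane_ne_zero hzb]
  simp only [hF0, zero_mul, sub_zero] at key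
  rw [rootIntegral]
  set J := ∫ t in (0 : ℝ)..1, kernelFun a b n B (t * z) * z
  linear_combination -((z - a) ^ B * (z - b) ^ ((n : ℂ) - B)) * key -
    F z * ((z - b) ^ ((n : ℂ) - B) * (z - b) ^ (-((n : ℂ) - B))) * e1 - F z * e2

/-- An analytic continuation of the integral formula to the unit disk solves the differential
equation. -/
theorem fuchsOp_of_eq_rootIntegral {a b : ℝ} (ha : a < 0) (ha1 : -1 < a) (hb : b < -1) {n : ℕ}
    {K B : ℂ} {F : ℂ → ℂ} (hF : AnalyticOnNhd ℂ F (Metric.ball 0 1))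
    (h : ∀ z : ℂ, ‖z‖ < 1 → z ≠ 0 → z - a ∈ Complex.slitPlane → F z = rootIntegral a b n K B z) :
    F 0 = 0 ∧ ∀ z ∈ Metric.ball (0 : ℂ) 1, fuchsOp a b B n F z = K * z ^ n := by
  have hmem : ∀ u ∈ Metric.ball (0 : ℂ) (-a), ‖u‖ < 1 ∧ u - a ∈ Complex.slitPlane ∧
      u - b ∈ Complex.slitPlane := by
    intro u hu
    have hu' : ‖u‖ < -a := by simpa using hu
    exact ⟨by linarith, sub_mem_slitPlane_of_norm_lt hu',
      sub_mem_slitPlane_of_norm_lt (by linarith)⟩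
  have hkd : DifferentiableOn ℂ (fun u => K * kernelFun a b n B u) (Metric.ball 0 (-a)) :=
    fun u hu => ((differentiableAt_kernelFun (hmem u hu).2.1
      (hmem u hu).2.2).const_mul K).differentiableWithinAt
  -- The disk of radius `-a` avoids both branch cuts, so the kernel has a primitive there.
  obtain ⟨P, hP⟩ := hkd.isExactOn_ball
  set S : ℂ → ℂ := fun z => (P z - P 0) * (z - a) ^ B * (z - b) ^ ((n : ℂ) - B) with hS
  have hSd : ∀ u ∈ Metric.ball (0 : ℂ) (-a), HasDerivAt S (((u - a) * (u - b) *
      (K * kernelFun a b n B u) + (B * (u - b) + ((n : ℂ) - B) * (u - a)) * (P u - P 0)) *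
      (u - a) ^ (B - 1) * (u - b) ^ ((n : ℂ) - B - 1)) u := fun u hu =>
    hasDerivAt_mul_cpow ((hP u hu).sub_const (P 0)) (hmem u hu).2.1 (hmem u hu).2.2
  have h0 : (0 : ℂ) ∈ Metric.ball (0 : ℂ) (-a) := Metric.mem_ball_self (by linarith)
  have hFS : ∀ u ∈ Metric.ball (0 : ℂ) (-a), u ≠ 0 → F u = S u := by
    intro u hu hu0
    obtain ⟨h1, h2, h3⟩ := hmem u hu
    have := integral_kernelFun (n := n) (K := K) (B := B) (P := P) ha hb h1 h2 (by
      intro v hv _ _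
      refine hP v ?_
      have hu' : ‖u‖ < -a := by simpa using hu
      simpa using hv.trans_lt hu')
    rw [h u h1 hu0 h2, rootIntegral, hS]
    simp only
    rw [← this]
    ring
  have hball : Metric.ball (0 : ℂ) (-a) ∈ 𝓝 (0 : ℂ) := Metric.isOpen_ball.mem_nhds h0
  -- The formula is not assumed at 0; continuity recovers it.
  have hF0 : F 0 = S 0 := by
    have l1 : Tendsto F (𝓝[≠] 0) (𝓝 (F 0)) :=
      (hF 0 (Metric.mem_ball_self one_pos)).continuousAt.tendsto.mono_left nhdsWithin_le_nhds
    have l2 : Tendsto S (𝓝[≠] 0) (𝓝 (S 0)) :=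
      (hSd 0 h0).continuousAt.tendsto.mono_left nhdsWithin_le_nhds
    refine tendsto_nhds_unique (l1.congr' ?_) l2
    filter_upwards [nhdsWithin_le_nhds hball, self_mem_nhdsWithin] with u hu hu0
    exact hFS u hu hu0
  have hFS' : ∀ u ∈ Metric.ball (0 : ℂ) (-a), F u = S u := by
    intro u hu
    rcases eq_or_ne u 0 with rfl | hu0
    · exact hF0
    · exact hFS u hu hu0
  have hloc : ∀ u ∈ Metric.ball (0 : ℂ) (-a), fuchsOp a b B n F u = K * u ^ n := by
    intro u hu
    obtain ⟨_, h2, h3⟩ := hmem u hu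
    have n2 := Complex.slitPlane_ne_zero h2
    have n3 := Complex.slitPlane_ne_zero h3
    have hd : deriv F u = deriv S u := by
      refine Filter.EventuallyEq.deriv_eq ?_
      filter_upwards [Metric.isOpen_ball.mem_nhds hu] with v hv using hFS' v hv
    rw [fuchsOp, hd, (hSd u hu).deriv, hFS' u hu, hS, kernelFun]
    have m2 : (u - a) ^ B ≠ 0 := by simp [Complex.cpow_eq_zero_iff, n2]
    have m3 : (u - b) ^ ((n : ℂ) - B) ≠ 0 := by simp [Complex.cpow_eq_zero_iff, n3]
    rw [Complex.cpow_sub _ _ n2, Complex.cpow_sub _ _ n3, Complex.cpow_one, Complex.cpow_one,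
      Complex.cpow_neg, Complex.cpow_neg,
      add_comm 1 B, add_comm 1 ((n : ℂ) - B), Complex.cpow_add _ _ n2, Complex.cpow_add _ _ n3,
      Complex.cpow_one, Complex.cpow_one]
    field_simp
    ring
  refine ⟨by rw [hF0]; simp [hS], ?_⟩
  -- Both sides are analytic in the whole disk, so the identity theorem carries the equation from
  -- the small disk across the cut.
  have hL : AnalyticOnNhd ℂ (fuchsOp a b B n F) (Metric.ball 0 1) := by
    intro z hz
    have h1 := hF z hz
    have h2 := h1.deriv
    unfold fuchsOp
    fun_prop
  have hR : AnalyticOnNhd ℂ (fun z : ℂ => K * z ^ n) (Metric.ball 0 1) := by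
    intro z _
    fun_prop
  refine hL.eqOn_of_preconnected_of_eventuallyEq hR (convex_ball (0 : ℂ) 1).isPreconnected
    (Metric.mem_ball_self one_pos) ?_
  filter_upwards [hball] with u hu using hloc u hu

/-! ### Generating functions -/

/-- The generating function of a sequence. -/
noncomputable def genSeries (C : ℕ → ℂ) (z : ℂ) : ℂ := ∑' s, C s * z ^ s

theorem summable_genSeries {C : ℕ → ℂ} {M : ℝ} (hC : ∀ s, ‖C s‖ ≤ M) {z : ℂ} (hz : ‖z‖ < 1) :
    Summable fun s => C s * z ^ s := by
  refine Summable.of_norm_bounded ((summable_geometric_of_lt_one (norm_nonneg z) hz).mul_left M)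
    fun s => ?_
  rw [norm_mul, norm_pow]
  gcongr
  exact hC s

theorem summable_genSeries_nat_mul {C : ℕ → ℂ} {M : ℝ} (hC : ∀ s, ‖C s‖ ≤ M) {z : ℂ}
    (hz : ‖z‖ < 1) : Summable fun s : ℕ => s * C s * z ^ s := by
  have h := summable_pow_mul_geometric_of_norm_lt_one 1 (r := ‖z‖) (by simpa using hz)
  refine Summable.of_norm_bounded (h.mul_left M) fun s => ?_
  rw [norm_mul, norm_mul, norm_pow, pow_one, Complex.norm_natCast]
  have := hC s
  calc (s : ℝ) * ‖C s‖ * ‖z‖ ^ s ≤ s * M * ‖z‖ ^ s := by gcongr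
    _ = M * (s * ‖z‖ ^ s) := by ring

theorem hasDerivAt_genSeries {C : ℕ → ℂ} {M : ℝ} (hC : ∀ s, ‖C s‖ ≤ M) {z : ℂ} (hz : ‖z‖ < 1) :
    HasDerivAt (genSeries C) (∑' s : ℕ, C s * (s * z ^ (s - 1))) z := by
  obtain ⟨r, hr1, hr2⟩ := exists_between hz
  have hr0 : 0 < r := (norm_nonneg z).trans_lt hr1
  have hM : 0 ≤ M := (norm_nonneg _).trans (hC 0)
  have hu : Summable fun s : ℕ => M * (s * r ^ (s - 1)) := by
    have h := summable_pow_mul_geometric_of_norm_lt_one 1 (r := r)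
      (by rwa [Real.norm_of_nonneg hr0.le])
    refine ((h.mul_left (M / r))).congr fun s => ?_
    rcases s with _ | s
    · simp
    · rw [Nat.add_sub_cancel, pow_one, pow_succ]; field_simp
  refine hasDerivAt_tsum_of_isPreconnected (g := fun s z => C s * z ^ s) hu
    (Metric.isOpen_ball (x := (0 : ℂ)) (ε := r)) (convex_ball (0 : ℂ) r).isPreconnected
    (fun s w _ => (hasDerivAt_pow s w).const_mul (C s)) (fun s w hw => ?_)
    (Metric.mem_ball_self hr0) (summable_genSeries hC (by simp)) (by simpa using hr1)
  have hw' : ‖w‖ ≤ r := by simpa using (Metric.mem_ball.1 hw).le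
  rw [norm_mul, norm_mul, norm_pow, Complex.norm_natCast]
  gcongr
  exact hC s

theorem differentiableOn_genSeries {C : ℕ → ℂ} {M : ℝ} (hC : ∀ s, ‖C s‖ ≤ M) :
    DifferentiableOn ℂ (genSeries C) (Metric.ball 0 1) := fun z hz =>
  (hasDerivAt_genSeries hC (by simpa using hz)).differentiableAt.differentiableWithinAt

theorem mul_deriv_genSeries {C : ℕ → ℂ} {M : ℝ} (hC : ∀ s, ‖C s‖ ≤ M) {z : ℂ} (hz : ‖z‖ < 1) :
    z * deriv (genSeries C) z = ∑' s : ℕ, s * C s * z ^ s := by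
  rw [(hasDerivAt_genSeries hC hz).deriv, ← tsum_mul_left]
  refine tsum_congr fun s => ?_
  rcases s with _ | s
  · simp
  · rw [Nat.add_sub_cancel, pow_succ]; ring

/-- The differential equation for the generating function of a fibre solution. -/
theorem IsFibreSolution.ode {β γ : ℝ} {p : ℕ} {E : ℂ} {C : ℕ → ℂ}
    (h : IsFibreSolution β γ p E C) {M : ℝ} (hC : ∀ s, ‖C s‖ ≤ M) {z : ℂ} (hz : ‖z‖ < 1) :
    (γ * z ^ 2 + z + β) * (p * genSeries C z + z * deriv (genSeries C) z) =
      (p / 2 + E + γ * (p - 1) * z) * z * genSeries C z + β * p * C 0 := by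
  have s0 := (summable_genSeries hC hz).hasSum
  have s1 := (summable_genSeries_nat_mul hC hz).hasSum
  rw [← mul_deriv_genSeries hC hz] at s1
  change HasSum _ (genSeries C z) at s0
  set S0 := genSeries C z
  set S1 := z * deriv (genSeries C) z
  have lower : HasSum (fun s : ℕ => (s : ℂ) * C (s - 1) * z ^ (s + 1)) (z ^ 2 * (S1 + S0)) := by
    rw [← hasSum_nat_add_iff' 1]
    simp only [Finset.range_one, Finset.sum_singleton, Nat.cast_zero, zero_mul, sub_zero]
    refine ((s1.add s0).mul_left (z ^ 2)).congr_fun fun s => ?_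
    rw [Nat.add_sub_cancel, pow_add z (s + 1), pow_add]
    push_cast
    ring
  have upper : HasSum (fun s : ℕ => ((p : ℂ) + s + 1) * C (s + 1) * z ^ (s + 1))
      (p * S0 + S1 - p * C 0) := by
    have := (hasSum_nat_add_iff' 1).2 ((s0.mul_left (p : ℂ)).add s1)
    simp only [Finset.range_one, Finset.sum_singleton, Nat.cast_zero, zero_mul, add_zero, pow_zero,
      mul_one] at this
    refine this.congr_fun fun s => ?_
    push_cast
    ring
  -- This is the recurrence multiplied by `z ^ (s + 1)` and summed over `s`.
  have total := (((s0.mul_left (z * (p / 2 - E))).add (s1.mul_left z)).add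
    (lower.mul_left (γ : ℂ))).add (upper.mul_left (β : ℂ))
  have zero : HasSum (fun _ : ℕ => (0 : ℂ)) _ := total.congr_fun fun s => by
    linear_combination -z ^ (s + 1) * h s
  have := zero.unique hasSum_zero
  linear_combination this

/-! ### Fibre solutions -/

theorem IsRootPair.factor {β γ a b : ℝ} (h : IsRootPair β γ a b) (z : ℂ) :
    (γ : ℂ) * z ^ 2 + z + β = γ * ((z - a) * (z - b)) := by
  have h1 : (γ : ℂ) * (a + b) = -1 := by exact_mod_cast h.sum
  have h2 : (γ : ℂ) * (a * b) = β := by exact_mod_cast h.prod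
  linear_combination z * h1 - h2

/-- The factor `z ^ p` absorbs the term `p g`, because `(z ^ p g)' = z ^ (p - 1) (p g + z g')`. The
condition on `B` matches the linear factor multiplying `F` at `z = a`. -/
theorem IsFibreSolution.fuchsOp_eq {β γ a b : ℝ} (hr : IsRootPair β γ a b) {n : ℕ} {E B : ℂ}
    {C : ℕ → ℂ} (h : IsFibreSolution β γ (n + 1) E C) {M : ℝ} (hC : ∀ s, ‖C s‖ ≤ M)
    (hB : B * (γ * (a - b)) = ((n + 1 : ℕ) : ℂ) / 2 + E + γ * n * a) {z : ℂ} (hz : ‖z‖ < 1) :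
    fuchsOp a b B n (fun z => z ^ (n + 1) * genSeries C z) z =
      C 0 * β * (n + 1 : ℕ) / γ * z ^ n := by
  have hγ : (γ : ℂ) ≠ 0 := by exact_mod_cast hr.pos.ne'
  have hd : HasDerivAt (genSeries C) (deriv (genSeries C) z) z :=
    (hasDerivAt_genSeries hC hz).differentiableAt.hasDerivAt
  have hd2 := ((hasDerivAt_pow (n + 1) z).fun_mul hd).deriv
  have hode := h.ode hC hz
  have hf := hr.factor z
  rw [fuchsOp, hd2, Nat.add_sub_cancel]
  rw [hf] at hode
  set G := genSeries C z
  set G' := deriv (genSeries C) z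
  field_simp
  rw [pow_succ]
  push_cast at hode hB ⊢
  linear_combination z ^ n * hode - z ^ n * z * G * hB

/-- For `p = 0` the source vanishes and a factor `z` cancels, leaving exponents with sum `-1`. -/
theorem IsFibreSolution.fuchsOp_eq_zero {β γ a b : ℝ} (hr : IsRootPair β γ a b) {E B : ℂ}
    {C : ℕ → ℂ} (h : IsFibreSolution β γ 0 E C) {M : ℝ} (hC : ∀ s, ‖C s‖ ≤ M)
    (hB : B * (γ * (a - b)) = E - γ * a) {z : ℂ} (hz : ‖z‖ < 1) (hz0 : z ≠ 0) :
    fuchsOp a b B (-1) (genSeries C) z = 0 := by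
  have hγ : (γ : ℂ) ≠ 0 := by exact_mod_cast hr.pos.ne'
  have hode := h.ode hC hz
  rw [hr.factor z] at hode
  rw [fuchsOp]
  set G := genSeries C z
  set G' := deriv (genSeries C) z
  push_cast at hode
  have : (γ * z) * ((z - a) * (z - b) * G' - (B * (z - b) + (-1 - B) * (z - a)) * G) = 0 := by
    linear_combination hode - z * G * hB
  exact (mul_eq_zero.1 this).resolve_left (mul_ne_zero hγ hz0)

theorem genSeries_zero (C : ℕ → ℂ) : genSeries C 0 = C 0 := by
  rw [genSeries, tsum_eq_single 0 fun s hs => by simp [hs]]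
  simp

theorem analyticOnNhd_genSeries {C : ℕ → ℂ} {M : ℝ} (hC : ∀ s, ‖C s‖ ≤ M) :
    AnalyticOnNhd ℂ (genSeries C) (Metric.ball 0 1) :=
  (differentiableOn_genSeries hC).analyticOnNhd Metric.isOpen_ball

/-- A bounded nonzero fibre solution has one of the energies of the harmonic spectrum. -/
theorem IsFibreSolution.energy {β γ a b : ℝ} (hr : IsRootPair β γ a b) {p : ℕ} {E : ℂ}
    {C : ℕ → ℂ} (h : IsFibreSolution β γ p E C) {M : ℝ} (hC : ∀ s, ‖C s‖ ≤ M) (h0 : C 0 ≠ 0) :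
    ∃ k : ℕ, E = ((γ * (a - b) - 1) / 2 + γ * (a - b) / 2 * (p + 2 * k : ℕ) : ℂ) := by
  have hgap : (γ * (a - b) : ℂ) ≠ 0 := by exact_mod_cast hr.gap_pos.ne'
  have hsum : (γ : ℂ) * (a + b) = -1 := by exact_mod_cast hr.sum
  have hab : (a : ℂ) ≠ b := fun hab => hgap (by rw [hab, sub_self, mul_zero])
  have ha1 : ‖(a : ℂ)‖ < 1 := by
    rw [Complex.norm_real, Real.norm_eq_abs, abs_lt]
    exact ⟨hr.neg_one_lt, hr.neg.trans one_pos⟩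
  have ha0 : (a : ℂ) ≠ 0 := by exact_mod_cast hr.neg.ne
  have hb0 : (b : ℂ) ≠ 0 := by
    have : b ≠ 0 := by linarith [hr.lt_neg_one]
    exact_mod_cast this
  have hγ : (γ : ℂ) ≠ 0 := by exact_mod_cast hr.pos.ne'
  have hβ : (β : ℂ) ≠ 0 := by exact_mod_cast hr.β_pos.ne'
  rcases p with _ | n
  · obtain ⟨B, hB⟩ : ∃ B : ℂ, B * (γ * (a - b)) = E - γ * a :=
      ⟨_, div_mul_cancel₀ _ hgap⟩
    have hball : Metric.ball (0 : ℂ) 1 ∈ 𝓝 (a : ℂ) :=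
      Metric.isOpen_ball.mem_nhds (by simpa using ha1)
    have hev : ∀ᶠ z in 𝓝 (a : ℂ), fuchsOp a b B (-1) (genSeries C) z = 0 := by
      filter_upwards [hball, isOpen_ne.mem_nhds ha0] with z hz hz0
      exact h.fuchsOp_eq_zero hr hC hB (by simpa using hz) hz0
    obtain ⟨m, rfl⟩ := exponent_of_homogeneous hab
      (analyticOnNhd_genSeries hC a (by simpa using ha1)) hev fun hz => h0 (by
        rw [← genSeries_zero C]
        exact (analyticOnNhd_genSeries hC).eqOn_zero_of_preconnected_of_eventuallyEq_zero
          (convex_ball (0 : ℂ) 1).isPreconnected (by simpa using ha1) hz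
          (Metric.mem_ball_self one_pos))
    refine ⟨m, ?_⟩
    push_cast
    linear_combination -hB + hsum / 2
  · obtain ⟨B, hB⟩ : ∃ B : ℂ, B * (γ * (a - b)) = ((n + 1 : ℕ) : ℂ) / 2 + E + γ * n * a :=
      ⟨_, div_mul_cancel₀ _ hgap⟩
    have hK : C 0 * β * (n + 1 : ℕ) / γ ≠ 0 :=
      div_ne_zero (mul_ne_zero (mul_ne_zero h0 hβ) (by exact_mod_cast n.succ_ne_zero)) hγ
    have han : AnalyticOnNhd ℂ (fun z => z ^ (n + 1) * genSeries C z) (Metric.ball 0 1) :=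
      fun z hz => (analyticAt_id.pow (n + 1)).mul (analyticOnNhd_genSeries hC z hz)
    obtain ⟨m, rfl, hm⟩ := exponent_of_inhomogeneous hab ha0 hb0 ha1 hK han (by simp)
      fun z hz => h.fuchsOp_eq hr hC hB (by simpa using hz)
    obtain ⟨k, rfl⟩ := Nat.exists_eq_add_of_le hm
    refine ⟨k, ?_⟩
    push_cast at hB ⊢
    linear_combination -hB - (n / 2 + 1 / 2) * hsum + hsum / 2

/-! ### Explicit bounded solutions of the recurrence -/

theorem natCast_mul_choose_pred (s j : ℕ) :
    (s : ℂ) * ((s - 1).choose j : ℂ) = (s - j) * (s.choose j : ℂ) := by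
  rcases s with _ | s
  · rcases j with _ | j <;> simp
  · rw [Nat.add_sub_cancel]
    rcases le_or_gt j (s + 1) with hj | hj
    · have h := congrArg (fun x : ℕ => (x : ℂ)) (Nat.choose_mul_succ_eq s j)
      push_cast [hj] at h ⊢
      linear_combination h
    · rw [Nat.choose_eq_zero_of_lt hj, Nat.choose_eq_zero_of_lt (by omega)]
      simp

theorem natCast_mul_choose_succ (p s j : ℕ) :
    ((p : ℂ) + s + 1) * ((s + 1).choose (j + 1) : ℂ) =
      (s + p + j + 2) * (s.choose (j + 1) : ℂ) + (p + j + 1) * (s.choose j : ℂ) := by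
  have h : (s.choose (j + 1) : ℂ) * (j + 1) = s.choose j * (s - j) := by
    rcases le_or_gt j s with hj | hj
    · have h := congrArg (fun x : ℕ => (x : ℂ)) (Nat.choose_succ_right_eq s j)
      push_cast [hj] at h
      exact h
    · rw [Nat.choose_eq_zero_of_lt hj, Nat.choose_eq_zero_of_lt (by omega)]
      simp
  rw [Nat.choose_succ_succ]
  push_cast
  linear_combination -h

/-- The coefficients, in the binomial basis, of the polynomial factor of a fibre solution. -/
noncomputable def binomialCoeff (γ a b : ℝ) (p k : ℕ) : ℕ → ℂ
  | 0 => 1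
  | j + 1 => γ * (a - b) * (k - j) * binomialCoeff γ a b p k j / (γ * a * (p + j + 1))

/-- The bounded fibre solution: a geometric sequence times a polynomial of degree `k`. -/
noncomputable def fibreSolution (γ a b : ℝ) (p k : ℕ) (s : ℕ) : ℂ :=
  ((b : ℂ)⁻¹) ^ s * ∑ j ∈ Finset.range (k + 1), binomialCoeff γ a b p k j * (s.choose j : ℂ)

theorem fibreSolution_zero (γ a b : ℝ) (p k : ℕ) : fibreSolution γ a b p k 0 = 1 := by
  rw [fibreSolution, Finset.sum_eq_single_of_mem 0 (by simp)]
  · simp [binomialCoeff]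
  · intro j _ hj
    rw [Nat.choose_eq_zero_of_lt (by omega)]
    simp

/-- The ansatz `b ^ (-s) Q s` turns the shift coefficients into `γ b` and `γ a`, since `β = γ a b`.
In the binomial basis the equation for `Q` becomes two-term, and the factor `k - j` ends it at
degree `k`. -/
theorem isFibreSolution_fibreSolution {β γ a b : ℝ} (hr : IsRootPair β γ a b) (p k : ℕ) :
    IsFibreSolution β γ p
      ((γ * (a - b) - 1) / 2 + γ * (a - b) / 2 * (p + 2 * k : ℕ) : ℂ)
      (fibreSolution γ a b p k) := by
  intro s
  have hsum : (γ : ℂ) * (a + b) = -1 := by exact_mod_cast hr.sum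
  have hprod : (γ : ℂ) * (a * b) = β := by exact_mod_cast hr.prod
  have ha0 : (a : ℂ) ≠ 0 := by exact_mod_cast hr.neg.ne
  have hγ : (γ : ℂ) ≠ 0 := by exact_mod_cast hr.pos.ne'
  have hb0 : (b : ℂ) ≠ 0 := by
    have : b ≠ 0 := by linarith [hr.lt_neg_one]
    exact_mod_cast this
  set E : ℂ := (γ * (a - b) - 1) / 2 + γ * (a - b) / 2 * (p + 2 * k : ℕ) with hE
  set d := binomialCoeff γ a b p k with hd
  have hrec : ∀ j : ℕ, d (j + 1) * (γ * a * (p + j + 1)) = γ * (a - b) * (k - j) * d j := by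
    intro j
    have : (p : ℂ) + j + 1 ≠ 0 := by exact_mod_cast (p + j).succ_ne_zero
    rw [hd, binomialCoeff, div_mul_cancel₀ _ (mul_ne_zero (mul_ne_zero hγ ha0) this)]
  -- The sum telescopes; its remainder carries the factor `J - k` and vanishes at `J = k`.
  have partialSum : ∀ J : ℕ, ∑ j ∈ Finset.range (J + 1), d j *
      (((p : ℂ) / 2 + s - E) * (s.choose j : ℂ) + γ * b * (s * ((s - 1).choose j : ℂ)) +
        γ * a * ((p + s + 1) * ((s + 1).choose j : ℂ))) =
      γ * (a - b) * (J - k) * d J * (s.choose J : ℂ) := by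
    intro J
    induction J with
    | zero =>
      have h1 := natCast_mul_choose_pred s 0
      simp only [zero_add, Finset.sum_range_one, Nat.choose_zero_right, Nat.cast_one, hE] at h1 ⊢
      push_cast
      linear_combination d 0 * (s + p / 2 + 1 / 2) * hsum
    | succ J ih =>
      rw [Finset.sum_range_succ, ih, natCast_mul_choose_pred, natCast_mul_choose_succ, hE]
      push_cast
      linear_combination (s.choose J : ℂ) * hrec J +
        d (J + 1) * (s.choose (J + 1) : ℂ) * (s + p / 2 + 1 / 2) * hsum
  have hk := partialSum k
  rw [sub_self, mul_zero, zero_mul, zero_mul] at hk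
  simp only [fibreSolution, ← hd]
  have hpred : (s : ℂ) * ((b : ℂ)⁻¹) ^ (s - 1) = s * (((b : ℂ)⁻¹) ^ s * b) := by
    rcases s with _ | s
    · simp
    · rw [Nat.add_sub_cancel, pow_succ]; field_simp
  have hsucc : (β : ℂ) * ((b : ℂ)⁻¹) ^ (s + 1) = γ * a * ((b : ℂ)⁻¹) ^ s := by
    rw [pow_succ, ← hprod]; field_simp
  have expand : ∑ j ∈ Finset.range (k + 1), d j *
      (((p : ℂ) / 2 + s - E) * (s.choose j : ℂ) + γ * b * (s * ((s - 1).choose j : ℂ)) +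
        γ * a * ((p + s + 1) * ((s + 1).choose j : ℂ))) =
      ((p : ℂ) / 2 + s - E) * ∑ j ∈ Finset.range (k + 1), d j * (s.choose j : ℂ) +
      γ * b * s * ∑ j ∈ Finset.range (k + 1), d j * ((s - 1).choose j : ℂ) +
      γ * a * (p + s + 1) * ∑ j ∈ Finset.range (k + 1), d j * ((s + 1).choose j : ℂ) := by
    rw [Finset.mul_sum, Finset.mul_sum, Finset.mul_sum, ← Finset.sum_add_distrib,
      ← Finset.sum_add_distrib]
    exact Finset.sum_congr rfl fun j _ => by ring
  rw [expand] at hk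
  linear_combination ((b : ℂ)⁻¹) ^ s * hk +
    γ * (∑ j ∈ Finset.range (k + 1), d j * ((s - 1).choose j : ℂ)) * hpred +
    (p + s + 1) * (∑ j ∈ Finset.range (k + 1), d j * ((s + 1).choose j : ℂ)) * hsucc

theorem norm_inv_lt_one {b : ℝ} (hb : b < -1) : ‖((b : ℂ)⁻¹)‖ < 1 := by
  rw [norm_inv, Complex.norm_real, Real.norm_eq_abs, abs_of_neg (by linarith)]
  exact inv_lt_one_of_one_lt₀ (by linarith)

theorem fibreSolution_bounded {γ a b : ℝ} (hb : b < -1) (p k : ℕ) :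
    ∃ M : ℝ, ∀ s, ‖fibreSolution γ a b p k s‖ ≤ M := by
  have hr : ‖‖((b : ℂ)⁻¹)‖‖ < 1 := by rw [norm_norm]; exact norm_inv_lt_one hb
  have hsum : Summable fun s => ‖fibreSolution γ a b p k s‖ := by
    have : Summable fun s : ℕ => ∑ j ∈ Finset.range (k + 1),
        ‖binomialCoeff γ a b p k j‖ * ((s : ℝ) ^ j * ‖((b : ℂ)⁻¹)‖ ^ s) :=
      summable_sum fun j _ =>
        (summable_pow_mul_geometric_of_norm_lt_one (R := ℝ) j hr).mul_left _
    refine Summable.of_nonneg_of_le (fun _ => norm_nonneg _) (fun s => ?_) this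
    rw [fibreSolution, Finset.mul_sum]
    refine (norm_sum_le _ _).trans (Finset.sum_le_sum fun j _ => ?_)
    rw [norm_mul, norm_mul, norm_pow, Complex.norm_natCast]
    have : (s.choose j : ℝ) ≤ (s : ℝ) ^ j := by exact_mod_cast Nat.choose_le_pow s j
    calc ‖((b : ℂ)⁻¹)‖ ^ s * (‖binomialCoeff γ a b p k j‖ * (s.choose j : ℝ))
        ≤ ‖((b : ℂ)⁻¹)‖ ^ s * (‖binomialCoeff γ a b p k j‖ * (s : ℝ) ^ j) := by gcongr
      _ = _ := by ring
  exact ⟨_, fun s => hsum.le_tsum s fun _ _ => norm_nonneg _⟩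

theorem IsFibreSolution.const_mul {β γ : ℝ} {p : ℕ} {E : ℂ} {C : ℕ → ℂ}
    (h : IsFibreSolution β γ p E C) (c : ℂ) : IsFibreSolution β γ p E fun s => c * C s := by
  intro s
  linear_combination c * h s

/-! ### The point spectrum -/

/-- This bound is all that the generating function argument uses of square summability. -/
theorem norm_weight_mul_le (p : ℕ) (Ψ : Fock) (x : ℕ × ℕ) (s : ℕ) :
    ‖(fibreWeight p s : ℂ) * (Ψ : Formal) x‖ ≤ ‖Ψ‖ := by
  rw [norm_mul, Complex.norm_real, Real.norm_of_nonneg (fibreWeight_pos p s).le]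
  calc fibreWeight p s * ‖(Ψ : Formal) x‖ ≤ 1 * ‖(Ψ : Formal) x‖ := by
        gcongr; exact fibreWeight_le_one p s
    _ ≤ ‖Ψ‖ := by rw [one_mul]; exact lp.norm_apply_le_norm two_ne_zero Ψ x

/-- The formal vector on the fibre `a* a - b* b = p` with rescaled coefficients `C`. -/
noncomputable def fibreVector (p : ℕ) (C : ℕ → ℂ) : Formal := fun x =>
  if x.1 = p + x.2 then C x.2 / fibreWeight p x.2 else 0

theorem fibreVector_fibrePos (p : ℕ) (C : ℕ → ℂ) (s : ℕ) :
    fibreVector p C (fibrePos p s) = C s / fibreWeight p s := by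
  simp [fibreVector, fibrePos]

theorem pairOperator_fibreVector {β γ : ℝ} {p : ℕ} {E : ℂ} {C : ℕ → ℂ}
    (h : IsFibreSolution β γ p E C) (x : ℕ × ℕ) :
    pairOperator β γ (fibreVector p C) x = E * fibreVector p C x := by
  by_cases hx : x.1 = p + x.2
  · rw [show x = fibrePos p x.2 from Prod.ext hx rfl]
    refine (fibre_equation_iff β γ (Or.inl rfl) E (fibreVector p C)).2 ?_ _
    convert h using 2 with s
    have hw : (fibreWeight p s : ℂ) ≠ 0 := by exact_mod_cast (fibreWeight_pos p s).ne'
    rw [fibreVector_fibrePos, mul_div_cancel₀ _ hw]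
  · obtain ⟨m, n⟩ := x
    simp only at hx
    rw [pairOperator_apply]
    have h1 : fibreVector p C (m, n) = 0 := if_neg hx
    have h2 : fibreVector p C (m + 1, n + 1) = 0 := if_neg (by simp only; omega)
    -- On the boundary the truncated index `m - 1` or `n - 1` could be misleading, but its
    -- coefficient contains `√0`.
    have h3 : (√(m : ℝ) : ℂ) * (√(n : ℝ) : ℂ) * fibreVector p C (m - 1, n - 1) = 0 := by
      rcases m with _ | m
      · simp
      rcases n with _ | n
      · simp
      rw [fibreVector, if_neg (by simp only; omega), mul_zero]
    rw [h1, h2, h3]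
    simp

/-- For `k = 0` the squared norms are `p! * choose (s + p) p * |b| ^ (-2 s)`, which are summable
because `|b| > 1`. -/
theorem memℓp_fibreVector {b : ℝ} (hb : b < -1) (γ a : ℝ) (p : ℕ) :
    Memℓp (fibreVector p (fibreSolution γ a b p 0)) 2 := by
  have hr := norm_inv_lt_one hb
  refine memℓp_gen ?_
  have hinj : Function.Injective (fibrePos p) := fun s t h => congrArg Prod.snd h
  rw [← hinj.summable_iff]
  · have hr2 : ‖(‖((b : ℂ)⁻¹)‖ ^ 2)‖ < 1 := by
      rw [norm_pow, norm_norm]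
      exact pow_lt_one₀ (norm_nonneg _) hr two_ne_zero
    refine ((summable_choose_mul_geometric_of_norm_lt_one p hr2).mul_left
      (p.factorial : ℝ)).congr fun s => ?_
    have hC : fibreSolution γ a b p 0 s = ((b : ℂ)⁻¹) ^ s := by
      simp [fibreSolution, binomialCoeff]
    have hw2 : fibreWeight p s ^ 2 = (s.factorial : ℝ) / ((p + s).factorial : ℝ) :=
      Real.sq_sqrt (by positivity)
    have hch : ((s + p).choose p : ℝ) * s.factorial * p.factorial = (p + s).factorial := by
      have := Nat.add_choose_mul_factorial_mul_factorial s p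
      rw [add_comm p s]
      exact_mod_cast this
    simp only [Function.comp_apply, fibreVector_fibrePos, hC, norm_div, norm_pow,
      Complex.norm_real, Real.norm_of_nonneg (fibreWeight_pos p s).le, ENNReal.toReal_ofNat,
      Real.rpow_ofNat, div_pow, hw2]
    rw [← hch, ← pow_mul, ← pow_mul, mul_comm 2 s]
    field_simp
  · intro x hx
    have : fibreVector p (fibreSolution γ a b p 0) x = 0 :=
      if_neg fun h => hx ⟨x.2, Prod.ext h.symm rfl⟩
    simp [this]

/-- The point spectrum of `(a* a + b* b) / 2 + β a b + γ a* b*`. -/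
theorem pointSpectrum_pairOperator {β γ a b : ℝ} (hr : IsRootPair β γ a b) :
    pointSpectrum (realize (pairOperator β γ)) =
      Set.range fun N : ℕ => (((γ * (a - b) - 1) / 2 + γ * (a - b) / 2 * N : ℝ) : ℂ) := by
  ext E
  constructor
  · rintro ⟨Ψ, hΨ⟩
    obtain ⟨hne, heq⟩ := (isEigenstate_realize_iff _ E Ψ).1 hΨ
    obtain ⟨x, hx⟩ : ∃ x, (Ψ : Formal) x ≠ 0 := by
      by_contra! h
      exact hne (lp.ext (funext h))
    obtain ⟨p, ι, s, hι, rfl⟩ := exists_fibre x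
    have hsol := (fibre_equation_iff β γ hι E Ψ).1 fun s => heq (ι s)
    obtain ⟨k, hk⟩ := hsol.energy hr (fun s => norm_weight_mul_le p Ψ (ι s) s) fun h0 => by
      have := hsol.eq_zero hr.β_pos h0 s
      have hw : (fibreWeight p s : ℂ) ≠ 0 := by exact_mod_cast (fibreWeight_pos p s).ne'
      exact hx ((mul_eq_zero.1 this).resolve_left hw)
    exact ⟨p + 2 * k, by rw [hk]; push_cast; ring⟩
  -- Level `N` is attained on the fibre `p = N` with `k = 0`.
  · rintro ⟨p, rfl⟩
    have hsol := isFibreSolution_fibreSolution hr p 0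
    have hmem := memℓp_fibreVector hr.lt_neg_one γ a p
    refine ⟨⟨_, hmem⟩, (isEigenstate_realize_iff _ _ _).2 ⟨fun h => ?_, fun x => ?_⟩⟩
    · have h1 := congrArg (fun Φ : Fock => (Φ : Formal) (fibrePos p 0)) h
      have h2 : fibreVector p (fibreSolution γ a b p 0) (fibrePos p 0) = 0 := h1
      rw [fibreVector_fibrePos, fibreSolution_zero] at h2
      have hw : (fibreWeight p 0 : ℂ) ≠ 0 := by exact_mod_cast (fibreWeight_pos p 0).ne'
      exact (one_div_ne_zero hw) h2
    · have := pairOperator_fibreVector hsol x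
      refine this.trans ?_
      congr 1
      push_cast
      ring

/-! ### Analyticity of the generating function -/

theorem integralFormula_eq_rootIntegral (y α : ℝ) (n : ℕ) (C₀ B z : ℂ) :
    integralFormula y α (n + 1) C₀ B z =
      rootIntegral (zPlus y α) (zMinus y α) n (C₀ * y₁ y α * (n + 1 : ℕ) / y₂ y α) B z := by
  have h : ((n + 1 : ℕ) : ℂ) - 1 - B = n - B := by push_cast; ring
  simp only [integralFormula, rootIntegral, kernelFun, h, Nat.add_sub_cancel]

/-- A bounded fibre solution has the explicit generating function. -/
theorem IsFibreSolution.genSeries_eq_genFun {y α : ℝ}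
    (hr : IsRootPair (y₁ y α) (y₂ y α) (zPlus y α) (zMinus y α)) {n : ℕ} {E B : ℂ}
    {C : ℕ → ℂ} (h : IsFibreSolution (y₁ y α) (y₂ y α) (n + 1) E C) {M : ℝ}
    (hC : ∀ s, ‖C s‖ ≤ M) (hB : B * (y₂ y α * (zPlus y α - zMinus y α)) =
      ((n + 1 : ℕ) : ℂ) / 2 + E + y₂ y α * n * zPlus y α) {z : ℂ} (hz : z ∈ slitDisk y α) :
    genSeries C z = genFun y α (n + 1) (C 0) B z := by
  obtain ⟨hz1, hz0, hza⟩ := hz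
  have hd : DifferentiableOn ℂ (fun z => z ^ (n + 1) * genSeries C z) (Metric.ball 0 1) :=
    (differentiable_id.pow (n + 1)).differentiableOn.mul (differentiableOn_genSeries hC)
  have := eq_rootIntegral hr.neg hr.lt_neg_one hd (by simp)
    (fun w hw => h.fuchsOp_eq hr hC hB (by simpa using hw)) hz1 hza
  rw [genFun, integralFormula_eq_rootIntegral, ← this]
  exact (mul_div_cancel_left₀ _ (pow_ne_zero _ hz0)).symm

theorem AnalyticInDisk.pow_mul_genFun {y α : ℝ} {p : ℕ} {C₀ B : ℂ}
    (h : AnalyticInDisk y α (genFun y α p C₀ B)) :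
    AnalyticInDisk y α (integralFormula y α p C₀ B) := by
  obtain ⟨F, hF, hFG⟩ := h
  refine ⟨fun z => z ^ p * F z, fun z hz => (analyticAt_id.pow p).mul (hF z hz), fun z hz => ?_⟩
  simp only [hFG hz, genFun]
  exact mul_div_cancel₀ _ (pow_ne_zero _ hz.2.1)

theorem exponent_of_analyticInDisk {y α : ℝ}
    (hr : IsRootPair (y₁ y α) (y₂ y α) (zPlus y α) (zMinus y α)) {n : ℕ} {C₀ B : ℂ}
    (hC₀ : C₀ ≠ 0) (h : AnalyticInDisk y α (integralFormula y α (n + 1) C₀ B)) :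
    ∃ m : ℕ, B = m ∧ n + 1 ≤ m := by
  obtain ⟨F, hF, hFI⟩ := h
  obtain ⟨h0, hode⟩ := fuchsOp_of_eq_rootIntegral hr.neg hr.neg_one_lt hr.lt_neg_one hF
    fun z hz hz0 hza => (hFI ⟨hz, hz0, hza⟩).trans (integralFormula_eq_rootIntegral y α n C₀ B z)
  have ha1 : ‖(zPlus y α : ℂ)‖ < 1 := by
    rw [Complex.norm_real, Real.norm_eq_abs, abs_lt]
    exact ⟨hr.neg_one_lt, hr.neg.trans one_pos⟩
  have hab : (zPlus y α : ℂ) ≠ zMinus y α := by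
    exact_mod_cast (hr.lt_neg_one.trans hr.neg_one_lt).ne'
  have hb0 : zMinus y α ≠ 0 := by linarith [hr.lt_neg_one]
  refine exponent_of_inhomogeneous hab (by exact_mod_cast hr.neg.ne) (by exact_mod_cast hb0) ha1
    ?_ hF h0 hode
  exact div_ne_zero (mul_ne_zero (mul_ne_zero hC₀ (by exact_mod_cast hr.β_pos.ne'))
    (by exact_mod_cast n.succ_ne_zero)) (by exact_mod_cast hr.pos.ne')

/-- The integral is not evaluated: a bounded fibre solution with exponent `n + 1 + k` has an
analytic generating function, which the integral formula must equal. -/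
theorem analyticInDisk_genFun {y α : ℝ}
    (hr : IsRootPair (y₁ y α) (y₂ y α) (zPlus y α) (zMinus y α)) {n m : ℕ} (hm : n + 1 ≤ m)
    (C₀ : ℂ) : AnalyticInDisk y α (genFun y α (n + 1) C₀ m) := by
  obtain ⟨k, rfl⟩ := Nat.exists_eq_add_of_le hm
  obtain ⟨M, hM⟩ := fibreSolution_bounded (γ := y₂ y α) (a := zPlus y α) hr.lt_neg_one (n + 1) k
  have hsol := (isFibreSolution_fibreSolution hr (n + 1) k).const_mul C₀
  have hbd : ∀ s, ‖C₀ * fibreSolution (y₂ y α) (zPlus y α) (zMinus y α) (n + 1) k s‖ ≤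
      ‖C₀‖ * M := fun s => by
    rw [norm_mul]
    exact mul_le_mul_of_nonneg_left (hM s) (norm_nonneg _)
  refine ⟨_, analyticOnNhd_genSeries hbd, fun z hz => ?_⟩
  have hsum : (y₂ y α : ℂ) * (zPlus y α + zMinus y α) = -1 := by exact_mod_cast hr.sum
  rw [hsol.genSeries_eq_genFun hr hbd (B := ((n + 1 + k : ℕ) : ℂ)) ?_ hz, fibreSolution_zero,
    mul_one]
  push_cast
  linear_combination (-(n : ℂ) / 2) * hsum

/-- The denominator `z₊ + 2 y₁` equals `-z₊ y₂ (z₊ - z₋)`, which reconciles the stated exponent with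
the one in the Fuchsian equation. -/
theorem exponentB_mul_gap {y α : ℝ}
    (hr : IsRootPair (y₁ y α) (y₂ y α) (zPlus y α) (zMinus y α)) (n : ℕ) (E : ℂ) :
    exponentB y α (n + 1) E * (y₂ y α * (zPlus y α - zMinus y α)) =
      ((n + 1 : ℕ) : ℂ) / 2 + E + y₂ y α * n * zPlus y α := by
  have hgap : (y₂ y α * (zPlus y α - zMinus y α) : ℂ) ≠ 0 := by exact_mod_cast hr.gap_pos.ne'
  have hsum : (y₂ y α : ℂ) * (zPlus y α + zMinus y α) = -1 := by exact_mod_cast hr.sum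
  have hprod : (y₂ y α : ℂ) * (zPlus y α * zMinus y α) = y₁ y α := by exact_mod_cast hr.prod
  have ha0 : (zPlus y α : ℂ) ≠ 0 := by exact_mod_cast hr.neg.ne
  have hden : (zPlus y α : ℂ) + 2 * y₁ y α =
      -(zPlus y α * (y₂ y α * (zPlus y α - zMinus y α))) := by
    linear_combination -2 * hprod + zPlus y α * hsum
  rw [exponentB, hden, div_mul_eq_mul_div, div_eq_iff (neg_ne_zero.2 (mul_ne_zero ha0 hgap))]
  push_cast
  rw [← hprod]
  linear_combination (n : ℂ) * zPlus y α * (y₂ y α * (zPlus y α - zMinus y α)) * hsum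

/-! ### Discreteness -/

theorem isClosedEmbedding_arithmetic (c : ℝ) {d : ℝ} (hd : d ≠ 0) :
    IsClosedEmbedding fun N : ℕ => ((c + d * N : ℝ) : ℂ) := by
  have h1 : IsClosedEmbedding ((↑) : ℝ → ℂ) := Complex.isometry_ofReal.isClosedEmbedding
  have h2 := ((Homeomorph.mulLeft₀ d hd).trans (Homeomorph.addLeft c)).isClosedEmbedding
  exact h1.comp (h2.comp Nat.isClosedEmbedding_coe_real)

end TwoSpecies

theorem mainTheorem2 (y α : ℝ) (hy₀ : 0 < y) (hy₁ : y < 1 / 2)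
    (hα₀ : 0 ≤ α) (hα₁ : α < alphaC y) (hz : |zPlus y α| < 1) :
    -- analyticity of the explicit formula, with and without the factor `z ^ (-p)`
    (∀ (p : ℕ) (C₀ B : ℂ), 0 < p → C₀ ≠ 0 →
      (AnalyticInDisk y α (genFun y α p C₀ B) ↔ ∃ m : ℕ, B = m ∧ p ≤ m) ∧
      (AnalyticInDisk y α (integralFormula y α p C₀ B) ↔ ∃ m : ℕ, B = m ∧ p ≤ m)) ∧
    -- the formula is the generating function of an eigenstate of energy `E`
    (∀ (p : ℕ) (ι : ℕ → ℕ × ℕ) (E : ℂ) (Ψ : Fock), 0 < p → (ι = fibrePos p ∨ ι = fibreNeg p) →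
      (∀ x, x ∉ Set.range ι → Ψ x = 0) →
      IsEigenstate (realize (transformedHamiltonian y α)) E Ψ →
      rescaledCoeff p ι Ψ 0 ≠ 0 ∧
      ∀ z ∈ slitDisk y α, HasSum (fun s => rescaledCoeff p ι Ψ s * z ^ s)
        (genFun y α p (rescaledCoeff p ι Ψ 0) (exponentB y α p E) z)) ∧
    -- the eigenvalues are discrete
    (IsClosed (pointSpectrum (realize (transformedHamiltonian y α))) ∧
      DiscreteTopology (pointSpectrum (realize (transformedHamiltonian y α)))) ∧
    -- and give the Bogoliubov spectrum
    (fun E : ℂ => (1 - 2 * α * y) * E - α * y) ''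
        pointSpectrum (realize (transformedHamiltonian y α)) =
      pointSpectrum (realize (hamiltonian y)) ∧
    pointSpectrum (realize (hamiltonian y)) = bogoliubovSpectrum y := by
  have hD := one_sub_two_mul_pos hy₀ hy₁ hα₁
  have hr := isRootPair hy₀ hy₁ hα₀ hα₁ hz
  have hαc := (alphaC_spec hy₀ hy₁).2.2.2.1
  have hr₀ := isRootPair hy₀ hy₁ le_rfl hαc (abs_zPlus_zero_lt hy₀ hy₁)
  have hspec := pointSpectrum_pairOperator hr
  have hspec₀ : pointSpectrum (realize (hamiltonian y)) =
      Set.range fun N : ℕ => (((√(1 - 4 * y ^ 2) - 1) / 2 + √(1 - 4 * y ^ 2) / 2 * N : ℝ) : ℂ) := by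
    have h := pointSpectrum_pairOperator hr₀
    rw [gap_eq hy₀ hy₁ le_rfl hαc, show y₁ y 0 = y by simp [y₁], show y₂ y 0 = y by simp [y₂],
      ← hamiltonian_eq_pairOperator] at h
    simpa using h
  rw [gap_eq hy₀ hy₁ hα₀ hα₁] at hspec
  have hT := transformedHamiltonian_eq_pairOperator y α hD.ne'
  rw [hT]
  refine ⟨?_, ?_, ?_, ?_, ?_⟩
  · intro p C₀ B hp hC₀
    obtain ⟨n, rfl⟩ := Nat.exists_eq_add_of_lt hp
    rw [zero_add]
    refine ⟨⟨fun h => exponent_of_analyticInDisk hr hC₀ h.pow_mul_genFun, ?_⟩,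
      ⟨fun h => exponent_of_analyticInDisk hr hC₀ h, ?_⟩⟩
    · rintro ⟨m, rfl, hm⟩
      exact analyticInDisk_genFun hr hm C₀
    · rintro ⟨m, rfl, hm⟩
      exact (analyticInDisk_genFun hr hm C₀).pow_mul_genFun
  · intro p ι E Ψ hp hι hsupp hΨ
    obtain ⟨n, rfl⟩ := Nat.exists_eq_add_of_lt hp
    rw [zero_add] at hι ⊢
    obtain ⟨hne, heq⟩ := (isEigenstate_realize_iff _ E Ψ).1 hΨ
    have hsol : IsFibreSolution (y₁ y α) (y₂ y α) (n + 1) E (rescaledCoeff (n + 1) ι Ψ) :=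
      (fibre_equation_iff _ _ hι E Ψ).1 fun s => heq (ι s)
    have hbd : ∀ s, ‖rescaledCoeff (n + 1) ι Ψ s‖ ≤ ‖Ψ‖ := fun s =>
      norm_weight_mul_le (n + 1) Ψ (ι s) s
    refine ⟨fun h0 => hne (lp.ext (funext fun x => ?_)), fun z hz => ?_⟩
    · by_cases hx : x ∈ Set.range ι
      · obtain ⟨s, rfl⟩ := hx
        have hw : (fibreWeight (n + 1) s : ℂ) ≠ 0 := by
          exact_mod_cast (fibreWeight_pos (n + 1) s).ne'
        exact (mul_eq_zero.1 (hsol.eq_zero hr.β_pos h0 s)).resolve_left hw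
      · exact hsupp x hx
    · rw [← hsol.genSeries_eq_genFun hr hbd (exponentB_mul_gap hr n E) hz]
      exact (summable_genSeries hbd hz.1).hasSum
  · have hκ := (alphaC_spec hy₀ hy₁).1
    have hemb := isClosedEmbedding_arithmetic ((√(1 - 4 * y ^ 2) / (1 - 2 * α * y) - 1) / 2)
      (d := √(1 - 4 * y ^ 2) / (1 - 2 * α * y) / 2) (by positivity)
    rw [hspec]
    exact ⟨hemb.isClosed_range, hemb.isEmbedding.toHomeomorph.symm.isEmbedding.discreteTopology⟩
  · rw [hspec, hspec₀, ← Set.range_comp]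
    congr 1
    funext N
    have hD' : (1 - 2 * α * y : ℂ) ≠ 0 := by exact_mod_cast hD.ne'
    have h1 : (1 - 2 * α * y : ℂ) * (√(1 - 4 * y ^ 2) / (1 - 2 * α * y)) = √(1 - 4 * y ^ 2) :=
      mul_div_cancel₀ _ hD'
    simp only [Function.comp_apply]
    push_cast
    linear_combination (1 / 2 + (N : ℂ) / 2) * h1
  · rw [hspec₀]
    ext E
    constructor
    · rintro ⟨N, rfl⟩
      -- The energies depend only on `n_a + n_b`, so one species suffices.
      exact ⟨N, 0, by push_cast; ring⟩
    · rintro ⟨na, nb, rfl⟩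
      exact ⟨na + nb, by push_cast; ring⟩
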